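/- Let $P_1,\dots,P_n$ be paths with at most one bend on the rectangular grid (all four shapes $\ulcorner,\urcorner,\llcorner,\lrcorner$ and straight paths allowed). They represent the $B_1$-EPG graph $G$ whose vertices are the paths, two distinct vertices being adjacent if and only if the two paths share at least one grid edge. For a path $P$ let $|hor(P)|$ be the length (number of grid edges) of its horizontal part, and let $|OPT|$ be the maximum size of an independent set of $G$. Maximum Independent Set admits a PTAS on $B_1$-EPG graphs, given by such a representation, in which all horizontal parts have length at most a constant $c$. More precisely, there is an absolute constant $d$ such that for all constants $c\in\mathbb N$ and $\varepsilon>0$ there are an algorithm and a constant $C=C(c,\varepsilon)$ such that, on every representation by $n\ge 1$ paths with $|hor(P_i)|\le c$ for all $i$, the algorithm finds an independent set of $G$ of size at least $(1-\varepsilon)|OPT|$ in at most $C\,n^{d}\,n^{3c/\varepsilon}$ steps, that is, in $\mathcal O^*(n^{3c/\varepsilon})$ time. (Steps are those of a random access machine with unit cost per operation and with addition, truncated subtraction and comparison of natural numbers, but no multiplication; for $n=0$ the algorithm also halts, with the empty set, in at most $C$ steps.) -/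

import Mathlib

namespace EPG

/-! ### Grid paths with at most one bend and their edge intersection graphs -/

/-- A path with at most one bend on the grid `ℕ × ℕ`: a horizontal part on row `cy`, between the
columns `cx` and `hx`, and a vertical part on column `cx`, between the rows `cy` and `vy`, meeting
at the corner `(cx, cy)`. The signs of `hx - cx` and `vy - cy` give the four shapes. If `hx = cx`
or `vy = cy` the path is straight, and `(cx, cy)` is then one of its ends. -/
structure OneBendPath where
  cx : ℕ
  cy : ℕ
  hx : ℕ
  vy : ℕ

/-- The grid edges of the horizontal part. -/
def OneBendPath.horEdges (P : OneBendPath) : Set (Sym2 (ℕ × ℕ)) :=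
  {e | ∃ x, min P.cx P.hx ≤ x ∧ x < max P.cx P.hx ∧ e = s((x, P.cy), (x + 1, P.cy))}

/-- The grid edges of the vertical part. -/
def OneBendPath.verEdges (P : OneBendPath) : Set (Sym2 (ℕ × ℕ)) :=
  {e | ∃ y, min P.cy P.vy ≤ y ∧ y < max P.cy P.vy ∧ e = s((P.cx, y), (P.cx, y + 1))}

/-- All grid edges of the path. -/
def OneBendPath.edges (P : OneBendPath) : Set (Sym2 (ℕ × ℕ)) :=
  P.horEdges ∪ P.verEdges

/-- The length `|hor(P)|` of the horizontal part (its number of grid edges). -/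
def OneBendPath.horLength (P : OneBendPath) : ℕ :=
  max P.cx P.hx - min P.cx P.hx

/-- The `B₁`-EPG graph represented by a finite family of paths: two distinct vertices are adjacent
if and only if their paths share at least one edge of the grid. -/
def epgGraph {n : ℕ} (P : Fin n → OneBendPath) : SimpleGraph (Fin n) where
  Adj i j := i ≠ j ∧ ((P i).edges ∩ (P j).edges).Nonempty
  symm := ⟨fun _ _ h => ⟨h.1.symm, by rw [Set.inter_comm]; exact h.2⟩⟩
  loopless := ⟨fun _ h => h.1 rfl⟩

/-! ### The machine model

A random access machine under the uniform cost criterion, without multiplication, programmed by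
structured programs: a program uses finitely many registers and finitely many unbounded arrays of
natural numbers (array cells are addressed by computed values); the elementary operations are
constants, reading a register, reading an array cell, addition, truncated subtraction, comparison,
assignment. Each of them takes one step. -/

/-- The contents of the registers and of the arrays. -/
structure Store where
  reg : ℕ → ℕ
  arr : ℕ → ℕ → ℕ

/-- Arithmetic expressions; `read a e` is the cell of the array `a` at the address `e`. -/
inductive Expr where
  | const (k : ℕ)
  | reg (r : ℕ)
  | read (a : ℕ) (e : Expr)
  | add (e₁ e₂ : Expr)
  | sub (e₁ e₂ : Expr)

/-- The value of an expression. -/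
def Expr.eval (s : Store) : Expr → ℕ
  | .const k => k
  | .reg r => s.reg r
  | .read a e => s.arr a (e.eval s)
  | .add e₁ e₂ => e₁.eval s + e₂.eval s
  | .sub e₁ e₂ => e₁.eval s - e₂.eval s

/-- The number of elementary operations that evaluate an expression. -/
def Expr.cost : Expr → ℕ
  | .const _ => 1
  | .reg _ => 1
  | .read _ e => e.cost + 1
  | .add e₁ e₂ => e₁.cost + e₂.cost + 1
  | .sub e₁ e₂ => e₁.cost + e₂.cost + 1

/-- Programs. -/
inductive Program where
  | skip
  | assign (r : ℕ) (e : Expr)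
  | write (a : ℕ) (e₁ e₂ : Expr)
  | seq (p q : Program)
  | ifLt (e₁ e₂ : Expr) (p q : Program)
  | whileLt (e₁ e₂ : Expr) (p : Program)

/-- Assign `v` to the register `r`. -/
def Store.setReg (s : Store) (r v : ℕ) : Store :=
  { s with reg := Function.update s.reg r v }

/-- Write `v` into the cell `i` of the array `a`. -/
def Store.setArr (s : Store) (a i v : ℕ) : Store :=
  { s with arr := Function.update s.arr a (Function.update (s.arr a) i v) }

/-- `Run p s t s'`: started in the store `s`, the program `p` halts after exactly `t` steps, in the
store `s'`. -/
inductive Run : Program → Store → ℕ → Store → Prop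
  | skip (s : Store) : Run .skip s 1 s
  | assign (r : ℕ) (e : Expr) (s : Store) :
      Run (.assign r e) s (e.cost + 1) (s.setReg r (e.eval s))
  | write (a : ℕ) (e₁ e₂ : Expr) (s : Store) :
      Run (.write a e₁ e₂) s (e₁.cost + e₂.cost + 1) (s.setArr a (e₁.eval s) (e₂.eval s))
  | seq {p q : Program} {s s' s'' : Store} {t t' : ℕ} :
      Run p s t s' → Run q s' t' s'' → Run (.seq p q) s (t + t') s''
  | ifTrue {e₁ e₂ : Expr} {p q : Program} {s s' : Store} {t : ℕ} :
      e₁.eval s < e₂.eval s → Run p s t s' →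
        Run (.ifLt e₁ e₂ p q) s (e₁.cost + e₂.cost + 1 + t) s'
  | ifFalse {e₁ e₂ : Expr} {p q : Program} {s s' : Store} {t : ℕ} :
      ¬ e₁.eval s < e₂.eval s → Run q s t s' →
        Run (.ifLt e₁ e₂ p q) s (e₁.cost + e₂.cost + 1 + t) s'
  | whileTrue {e₁ e₂ : Expr} {p : Program} {s s' s'' : Store} {t t' : ℕ} :
      e₁.eval s < e₂.eval s → Run p s t s' → Run (.whileLt e₁ e₂ p) s' t' s'' →
        Run (.whileLt e₁ e₂ p) s (e₁.cost + e₂.cost + 1 + t + t') s''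
  | whileFalse {e₁ e₂ : Expr} {p : Program} {s : Store} :
      ¬ e₁.eval s < e₂.eval s → Run (.whileLt e₁ e₂ p) s (e₁.cost + e₂.cost + 1) s

/-- The machine is deterministic: running time and result are determined by program and input. -/
theorem Run.deterministic {p : Program} {s s₁ s₂ : Store} {t₁ t₂ : ℕ}
    (h₁ : Run p s t₁ s₁) (h₂ : Run p s t₂ s₂) : t₁ = t₂ ∧ s₁ = s₂ := by
  induction h₁ generalizing t₂ s₂ with
  | skip | assign | write => cases h₂; exact ⟨rfl, rfl⟩
  | seq _ _ ih ih' =>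
    cases h₂ with
    | seq a b =>
      obtain ⟨rfl, rfl⟩ := ih a
      obtain ⟨rfl, rfl⟩ := ih' b
      exact ⟨rfl, rfl⟩
  | ifTrue h _ ih =>
    cases h₂ with
    | ifTrue _ a =>
      obtain ⟨rfl, rfl⟩ := ih a
      exact ⟨rfl, rfl⟩
    | ifFalse h' _ => exact absurd h h'
  | ifFalse h _ ih =>
    cases h₂ with
    | ifTrue h' _ => exact absurd h' h
    | ifFalse _ a =>
      obtain ⟨rfl, rfl⟩ := ih a
      exact ⟨rfl, rfl⟩
  | whileTrue h _ _ ih ih' =>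
    cases h₂ with
    | whileTrue _ a b =>
      obtain ⟨rfl, rfl⟩ := ih a
      obtain ⟨rfl, rfl⟩ := ih' b
      exact ⟨rfl, rfl⟩
    | whileFalse h' => exact absurd h h'
  | whileFalse h =>
    cases h₂ with
    | whileTrue h' _ _ => exact absurd h' h
    | whileFalse _ => exact ⟨rfl, rfl⟩

/-! ### Input and output -/

/-- The initial store on an instance: register `0` holds the number `n` of paths, the arrays
`0, 1, 2, 3` hold the coordinates `cx, cy, hx, vy` of the `n` paths, everything else is `0`. -/
def inputStore {n : ℕ} (P : Fin n → OneBendPath) : Store where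
  reg r := if r = 0 then n else 0
  arr a i :=
    if h : i < n then
      if a = 0 then (P ⟨i, h⟩).cx
      else if a = 1 then (P ⟨i, h⟩).cy
      else if a = 2 then (P ⟨i, h⟩).hx
      else if a = 3 then (P ⟨i, h⟩).vy
      else 0
    else 0

/-- The set of vertices that a final store describes: array `4` is its characteristic vector. -/
def outputSet (n : ℕ) (s : Store) : Finset (Fin n) :=
  Finset.univ.filter fun i => s.arr 4 i ≠ 0

end EPG

namespace EPG

/-! ### Stores -/

/-! The proof combines the shifting technique with an exact dynamic program.

Only the order of the columns that carry a corner or an end of a horizontal part matters, so columns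
are replaced by their ranks (`columnRank`). This never lengthens a horizontal part
(`columnRank_le_add`). Let k = ⌈c/ε⌉ + 1. For each shift j < k, the ranks are divided into slabs of
k consecutive columns, and the paths with corner and horizontal end in different slabs are dropped.
A path is dropped for at most |hor(P)| ≤ c shifts (`card_cut_le`). By averaging, some shift destroys
at most the share c/k ≤ ε of an optimal set (`exists_shift`, `exists_value_ge`).

For one shift the surviving paths are treated exactly. They are scanned slab by slab, and inside a
slab by the height of the corner. A slab has 2k slots: its k columns, and k gaps to the right of a
column (the last gap is never used). It is enough to remember, for each slot, the last chosen path
that uses it. Suppose a new path p conflicts with a chosen q. Then they have a common slot on which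
every path e scanned between them and not in conflict with q conflicts with p. On a gap, e lies in
the common row of q and p. On a column, e is disjoint from q and therefore lies above q, and p,
which reaches below the top of q, runs into e. This is `SlotSystem.Valid`, proved in
`shiftSystem_valid`; `Valid.indep_insert` and `Valid.card_le_value` derive from it the soundness and
the optimality of the dynamic program. A state is a number with 2k digits in base n + 1, where 0
means that no path is remembered.

The machine neither multiplies nor divides, so digits are handled through tables. The algorithm is
written in `LoopProgram`, whose meaning is the function `exec`. `run_compile` transfers results to
the machine, and `cost_le` bounds the time by a constant times the largest product of nested loop
limits. This gives O(k² n² (n + 1)^(2k)) steps for n ≥ 1, and 2k ≤ 2c/ε + 4 leads to the stated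
bound (`time_bound`). -/

@[simp] theorem Store.setReg_reg (s : Store) (r v r' : ℕ) :
    (s.setReg r v).reg r' = if r' = r then v else s.reg r' := by
  simp [Store.setReg, Function.update_apply]

@[simp] theorem Store.setReg_arr (s : Store) (r v : ℕ) : (s.setReg r v).arr = s.arr := rfl

@[simp] theorem Store.setArr_reg (s : Store) (a i v : ℕ) : (s.setArr a i v).reg = s.reg := rfl

@[simp] theorem Store.setArr_arr (s : Store) (a i v a' i' : ℕ) :
    (s.setArr a i v).arr a' i' = if a' = a ∧ i' = i then v else s.arr a' i' := by
  by_cases h : a' = a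
  · subst h; simp [Store.setArr, Function.update_apply]
  · simp [Store.setArr, h]

theorem Store.setArr_arr_of_ne (s : Store) (a i v : ℕ) {a' : ℕ} (h : a' ≠ a) :
    (s.setArr a i v).arr a' = s.arr a' := by
  simp [Store.setArr, h]

/-! ### Boolean and lattice operations on expressions; a value is true if it is positive -/

namespace Expr

/-- Conjunction. -/
def and (x y : Expr) : Expr := .sub (.const 1) (.add (.sub (.const 1) x) (.sub (.const 1) y))
/-- Disjunction. -/
def or (x y : Expr) : Expr := .sub (.const 1) (.sub (.const 1) (.add x y))
/-- Strict inequality. -/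
def lt (x y : Expr) : Expr := .sub (.const 1) (.sub (.const 1) (.sub y x))
/-- Equality. -/
def eq (x y : Expr) : Expr := .sub (.const 1) (.add (.sub x y) (.sub y x))
/-- Minimum. -/
def min (x y : Expr) : Expr := .sub x (.sub x y)
/-- Maximum. -/
def max (x y : Expr) : Expr := .add x (.sub y x)

variable (s : Store) (x y : Expr)

@[simp] theorem eval_const (k : ℕ) : (Expr.const k).eval s = k := rfl
@[simp] theorem eval_reg (r : ℕ) : (Expr.reg r).eval s = s.reg r := rfl
@[simp] theorem eval_read (a : ℕ) : (Expr.read a x).eval s = s.arr a (x.eval s) := rfl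
@[simp] theorem eval_add : (Expr.add x y).eval s = x.eval s + y.eval s := rfl
@[simp] theorem eval_sub : (Expr.sub x y).eval s = x.eval s - y.eval s := rfl

theorem eval_lt : (lt x y).eval s = if x.eval s < y.eval s then 1 else 0 := by
  simp only [lt, eval_sub, eval_const]; split <;> omega

@[simp] theorem eval_min : (min x y).eval s = Min.min (x.eval s) (y.eval s) := by
  simp only [min, eval_sub]; omega

@[simp] theorem eval_max : (max x y).eval s = Max.max (x.eval s) (y.eval s) := by
  simp only [max, eval_sub, eval_add]; omega

@[simp] theorem lt_pos : 0 < (lt x y).eval s ↔ x.eval s < y.eval s := by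
  rw [eval_lt]; split <;> simp_all

@[simp] theorem eq_pos : 0 < (eq x y).eval s ↔ x.eval s = y.eval s := by
  simp only [eq, eval_sub, eval_add, eval_const]; omega

@[simp] theorem and_pos : 0 < (and x y).eval s ↔ 0 < x.eval s ∧ 0 < y.eval s := by
  simp only [and, eval_sub, eval_add, eval_const]; omega

@[simp] theorem or_pos : 0 < (or x y).eval s ↔ 0 < x.eval s ∨ 0 < y.eval s := by
  simp only [or, eval_sub, eval_add, eval_const]; omega

theorem eval_or : (or x y).eval s = if 0 < x.eval s ∨ 0 < y.eval s then 1 else 0 := by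
  simp only [or, eval_sub, eval_add, eval_const]; split <;> omega

end Expr

/-! ### Loop programs

Programs whose only loops are `for` loops with limits in the registers below `10`, which are never
written. -/

/-- Loop programs; `loop r l p` runs `p` for the values `0, …, L - 1` of the register `r`, where `L`
is the value of the register `l`. -/
inductive LoopProgram where
  | skip
  | assign (r : ℕ) (e : Expr)
  | write (a : ℕ) (e₁ e₂ : Expr)
  | seq (p q : LoopProgram)
  | ifLt (e₁ e₂ : Expr) (p q : LoopProgram)
  | loop (r l : ℕ) (p : LoopProgram)

namespace LoopProgram

/-- Translation into programs. -/
def compile : LoopProgram → Program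
  | skip => .skip
  | assign r e => .assign r e
  | write a e₁ e₂ => .write a e₁ e₂
  | seq p q => .seq p.compile q.compile
  | ifLt e₁ e₂ p q => .ifLt e₁ e₂ p.compile q.compile
  | loop r l p => .seq (.assign r (.const 0)) (.whileLt (.reg r) (.reg l)
      (.seq p.compile (.assign r (.add (.reg r) (.const 1)))))

/-- The store after `m` rounds of a loop with counter `r` and body `f`. -/
def rounds (f : Store → Store) (r : ℕ) (s : Store) : ℕ → Store
  | 0 => s.setReg r 0
  | m + 1 => (f (rounds f r s m)).setReg r (m + 1)

/-- The final store. -/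
def exec : LoopProgram → Store → Store
  | skip, s => s
  | assign r e, s => s.setReg r (e.eval s)
  | write a e₁ e₂, s => s.setArr a (e₁.eval s) (e₂.eval s)
  | seq p q, s => q.exec (p.exec s)
  | ifLt e₁ e₂ p q, s => if e₁.eval s < e₂.eval s then p.exec s else q.exec s
  | loop r l p, s => rounds p.exec r s (s.reg l)

/-- Whether the register `x` occurs on a left-hand side. -/
def writesReg : LoopProgram → ℕ → Bool
  | skip, _ => false
  | assign r _, x => x == r
  | write _ _ _, _ => false
  | seq p q, x => p.writesReg x || q.writesReg x
  | ifLt _ _ p q, x => p.writesReg x || q.writesReg x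
  | loop r _ p, x => x == r || p.writesReg x

/-- Whether the array `x` occurs on a left-hand side. -/
def writesArr : LoopProgram → ℕ → Bool
  | skip, _ => false
  | assign _ _, _ => false
  | write a _ _, x => x == a
  | seq p q, x => p.writesArr x || q.writesArr x
  | ifLt _ _ p q, x => p.writesArr x || q.writesArr x
  | loop _ _ p, x => p.writesArr x

/-- No limit register and no running counter is written. -/
def wf : LoopProgram → Bool
  | skip => true
  | assign r _ => decide (10 ≤ r)
  | write _ _ _ => true
  | seq p q => p.wf && q.wf
  | ifLt _ _ p q => p.wf && q.wf
  | loop r l p => decide (10 ≤ r) && decide (l < 10) && !p.writesReg r && p.wf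

/-- A bound on the number of steps, `L` being the contents of the limit registers. -/
def cost (L : ℕ → ℕ) : LoopProgram → ℕ
  | skip => 1
  | assign _ e => e.cost + 1
  | write _ e₁ e₂ => e₁.cost + e₂.cost + 1
  | seq p q => p.cost L + q.cost L
  | ifLt e₁ e₂ p q => e₁.cost + e₂.cost + 1 + (p.cost L + q.cost L)
  | loop _ l p => L l * (p.cost L + 7) + 5

/-- Frame property. Since `writesReg` computes, the hypothesis is closed by `rfl` for concrete
programs. -/
theorem exec_reg (p : LoopProgram) (s : Store) {x : ℕ} (h : p.writesReg x = false) :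
    (p.exec s).reg x = s.reg x := by
  induction p generalizing s with
  | skip => rfl
  | assign r e =>
    have : x ≠ r := by simpa [writesReg] using h
    simp [exec, this]
  | write a e₁ e₂ => simp [exec]
  | seq p q ihp ihq =>
    simp only [writesReg, Bool.or_eq_false_iff] at h
    simp only [exec]; rw [ihq _ h.2, ihp _ h.1]
  | ifLt e₁ e₂ p q ihp ihq =>
    simp only [writesReg, Bool.or_eq_false_iff] at h
    simp only [exec]; split
    · exact ihp _ h.1
    · exact ihq _ h.2
  | loop r l p ih =>
    simp only [writesReg, Bool.or_eq_false_iff, beq_eq_false_iff_ne] at h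
    simp only [exec]
    generalize s.reg l = m
    induction m with
    | zero => simp [rounds, h.1]
    | succ m ihm => simp [rounds, h.1, ih _ h.2, ihm]

theorem exec_arr (p : LoopProgram) (s : Store) {x : ℕ} (h : p.writesArr x = false) :
    (p.exec s).arr x = s.arr x := by
  induction p generalizing s with
  | skip => rfl
  | assign r e => simp [exec]
  | write a e₁ e₂ =>
    have : x ≠ a := by simpa [writesArr] using h
    simp [exec, Store.setArr_arr_of_ne, this]
  | seq p q ihp ihq =>
    simp only [writesArr, Bool.or_eq_false_iff] at h
    simp only [exec]; rw [ihq _ h.2, ihp _ h.1]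
  | ifLt e₁ e₂ p q ihp ihq =>
    simp only [writesArr, Bool.or_eq_false_iff] at h
    simp only [exec]; split
    · exact ihp _ h.1
    · exact ihq _ h.2
  | loop r l p ih =>
    simp only [writesArr] at h
    simp only [exec]
    generalize s.reg l = m
    induction m with
    | zero => simp [rounds]
    | succ m ihm => simp [rounds, ih _ h, ihm]

theorem writesReg_of_wf {p : LoopProgram} (h : p.wf) {x : ℕ} (hx : x < 10) :
    p.writesReg x = false := by
  induction p with
  | skip => rfl
  | assign r e =>
    simp only [wf, decide_eq_true_eq] at h
    simp only [LoopProgram.writesReg, beq_eq_false_iff_ne]; omega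
  | write a e₁ e₂ => rfl
  | seq p q ihp ihq | ifLt _ _ p q ihp ihq =>
    simp only [wf, Bool.and_eq_true] at h
    simp [LoopProgram.writesReg, ihp h.1, ihq h.2]
  | loop r l p ih =>
    simp only [wf, Bool.and_eq_true, decide_eq_true_eq] at h
    simp only [LoopProgram.writesReg, Bool.or_eq_false_iff, beq_eq_false_iff_ne]
    exact ⟨by omega, ih h.2⟩

theorem rounds_reg {f : Store → Store} {r : ℕ} (s : Store) (m : ℕ) :
    (rounds f r s m).reg r = m := by
  cases m <;> simp [rounds]

/-- A loop program halts in its `exec`, within its `cost`. -/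
theorem run_compile (L : ℕ → ℕ) (p : LoopProgram) (h : p.wf) (s : Store)
    (hL : ∀ l < 10, s.reg l = L l) : ∃ t ≤ p.cost L, Run p.compile s t (p.exec s) := by
  induction p generalizing s with
  | skip => exact ⟨1, le_rfl, .skip s⟩
  | assign r e => exact ⟨_, le_rfl, .assign r e s⟩
  | write a e₁ e₂ => exact ⟨_, le_rfl, .write a e₁ e₂ s⟩
  | seq p q ihp ihq =>
    simp only [wf, Bool.and_eq_true] at h
    obtain ⟨t, ht, hr⟩ := ihp h.1 s hL
    obtain ⟨t', ht', hr'⟩ := ihq h.2 (p.exec s) fun l hl => by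
      rw [exec_reg _ _ (writesReg_of_wf h.1 hl), hL l hl]
    exact ⟨_, by simp only [cost]; omega, hr.seq hr'⟩
  | ifLt e₁ e₂ p q ihp ihq =>
    simp only [wf, Bool.and_eq_true] at h
    by_cases hc : e₁.eval s < e₂.eval s
    · obtain ⟨t, ht, hr⟩ := ihp h.1 s hL
      refine ⟨e₁.cost + e₂.cost + 1 + t, by simp only [cost]; omega, ?_⟩
      simp only [exec, if_pos hc]
      exact .ifTrue hc hr
    · obtain ⟨t, ht, hr⟩ := ihq h.2 s hL
      refine ⟨e₁.cost + e₂.cost + 1 + t, by simp only [cost]; omega, ?_⟩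
      simp only [exec, if_neg hc]
      exact .ifFalse hc hr
  | loop r l p ih =>
    simp only [wf, Bool.and_eq_true, decide_eq_true_eq, Bool.not_eq_true'] at h
    obtain ⟨⟨⟨hr10, hl⟩, hpr⟩, hp⟩ := h
    have hreg : ∀ m, ∀ x < 10, (rounds p.exec r s m).reg x = L x := by
      intro m x hx
      have hxr : x ≠ r := by omega
      induction m with
      | zero => simp [rounds, hxr, hL x hx]
      | succ m ihm => simp [rounds, hxr, exec_reg _ _ (writesReg_of_wf hp hx), ihm]
    -- Induction on the number j of rounds left. A round costs 3 steps for the test and 4 for the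
    -- increment besides the body; the last, failing test costs 3.
    have key : ∀ j m, m + j = s.reg l → ∃ t ≤ j * (p.cost L + 7) + 3,
        Run (.whileLt (.reg r) (.reg l) (.seq p.compile (.assign r (.add (.reg r) (.const 1)))))
          (rounds p.exec r s m) t (rounds p.exec r s (s.reg l)) := by
      intro j
      induction j with
      | zero =>
        intro m hm
        obtain rfl : m = s.reg l := by omega
        refine ⟨_, ?_, .whileFalse ?_⟩
        · simp [Expr.cost]
        · simp [rounds_reg, hreg _ l hl, hL l hl]
      | succ j ihj =>
        intro m hm
        obtain ⟨t, ht, hrun⟩ := ihj (m + 1) (by omega)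
        obtain ⟨t', ht', hrun'⟩ := ih hp (rounds p.exec r s m) (hreg m)
        have hinc := Run.assign r (.add (.reg r) (.const 1)) (p.exec (rounds p.exec r s m))
        have : (Expr.add (.reg r) (.const 1)).eval (p.exec (rounds p.exec r s m)) = m + 1 := by
          simp [exec_reg _ _ hpr, rounds_reg]
        rw [this] at hinc
        refine ⟨_, ?_, .whileTrue ?_ (hrun'.seq hinc) hrun⟩
        · simp only [Expr.cost]; rw [add_one_mul]; omega
        · simp only [Expr.eval_reg, rounds_reg, hreg _ l hl, ← hL l hl]; omega
    obtain ⟨t, ht, hrun⟩ := key (s.reg l) 0 (by omega)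
    refine ⟨_, ?_, (Run.assign r (.const 0) s).seq hrun⟩
    simp only [cost, Expr.cost, ← hL l hl]; omega

/-- Loop invariants. -/
theorem exec_loop {r l : ℕ} {p : LoopProgram} {s : Store} {m : ℕ} (hm : s.reg l = m)
    (Q : ℕ → Store → Prop)
    (h0 : Q 0 (s.setReg r 0))
    (hs : ∀ i s', i < m → s'.reg r = i →
      (∀ x, x ≠ r → p.writesReg x = false → s'.reg x = s.reg x) →
      (∀ x, p.writesArr x = false → s'.arr x = s.arr x) →
      Q i s' → Q (i + 1) ((p.exec s').setReg r (i + 1))) :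
    Q m ((loop r l p).exec s) := by
  subst hm
  have key : ∀ m ≤ s.reg l, Q m (rounds p.exec r s m) ∧
      (∀ x, x ≠ r → p.writesReg x = false → (rounds p.exec r s m).reg x = s.reg x) ∧
      (∀ x, p.writesArr x = false → (rounds p.exec r s m).arr x = s.arr x) := by
    intro m
    induction m with
    | zero => exact fun _ => ⟨h0, fun x hx _ => by simp [rounds, hx], fun x _ => rfl⟩
    | succ m ih =>
      intro hm
      obtain ⟨h1, h2, h3⟩ := ih (by omega)
      refine ⟨hs m _ hm (rounds_reg s m) h2 h3 h1, fun x hx hw => ?_, fun x hw => ?_⟩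
      · simp [rounds, hx, exec_reg _ _ hw, h2 x hx hw]
      · simp [rounds, exec_arr _ _ hw, h3 x hw]
  exact (key _ le_rfl).1

end LoopProgram

/-! ### Numbers as digit sequences -/

/-- Horner's scheme: the number with the digits `d (K - s), …, d (K - 1)`, lowest digit first. -/
def horner (B : ℕ) (d : ℕ → ℕ) (K : ℕ) : ℕ → ℕ
  | 0 => 0
  | s + 1 => horner B d K s * B + d (K - 1 - s)

/-- The digits of a number. -/
def digit (B σ s : ℕ) : ℕ := σ / B ^ s % B

theorem horner_lt {B : ℕ} {d : ℕ → ℕ} {K : ℕ} (hd : ∀ s < K, d s < B) {s : ℕ} (hs : s ≤ K) :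
    horner B d K s < B ^ s := by
  induction s with
  | zero => simp [horner]
  | succ s ih =>
    have h1 := ih (by omega)
    have h2 := hd (K - 1 - s) (by omega)
    rw [horner, pow_succ]
    calc horner B d K s * B + d (K - 1 - s) < horner B d K s * B + B := by omega
      _ = (horner B d K s + 1) * B := by ring
      _ ≤ B ^ s * B := Nat.mul_le_mul_right _ h1

/-- Each round of Horner's scheme appends a lowest digit and moves the earlier ones up one place;
division by B undoes this. -/
theorem digit_horner {B : ℕ} {d : ℕ → ℕ} {K : ℕ} (hd : ∀ s < K, d s < B) {s : ℕ} (hs : s ≤ K)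
    {t : ℕ} (ht : t < s) : digit B (horner B d K s) t = d (K - s + t) := by
  induction s generalizing t with
  | zero => omega
  | succ s ih =>
    have h2 := hd (K - 1 - s) (by omega)
    cases t with
    | zero =>
      rw [digit, horner, pow_zero, Nat.div_one, Nat.mul_add_mod', Nat.mod_eq_of_lt h2]
      congr 1; omega
    | succ t =>
      have h3 : (horner B d K s * B + d (K - 1 - s)) / B = horner B d K s := by
        rw [mul_comm, Nat.mul_add_div (by omega), Nat.div_eq_of_lt h2, add_zero]
      have := ih (by omega) (t := t) (by omega)
      rw [digit] at this ⊢
      rw [horner, pow_succ', ← Nat.div_div_eq_div_mul, h3, this]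
      congr 1; omega

/-! ### Maximum independent sets by dynamic programming over slots -/

/-- Vertices `0, …, n - 1` arranged in a linear order (`pos` and `ord` are inverse to each other),
each using some of the slots `0, …, K - 1`; only the alive vertices count. -/
structure SlotSystem where
  n : ℕ
  K : ℕ
  alive : ℕ → Prop
  use : ℕ → ℕ → Prop
  adj : ℕ → ℕ → Prop
  pos : ℕ → ℕ
  ord : ℕ → ℕ

namespace SlotSystem

/-- The property that makes it enough to remember, for each slot, the last vertex that uses it. -/
structure Valid (I : SlotSystem) : Prop where
  pos_lt : ∀ i < I.n, I.pos i < I.n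
  ord_lt : ∀ p < I.n, I.ord p < I.n
  pos_ord : ∀ p < I.n, I.pos (I.ord p) = p
  ord_pos : ∀ i < I.n, I.ord (I.pos i) = i
  symm : ∀ i j, I.adj i j → I.adj j i
  slot : ∀ q < I.n, ∀ p < I.n, I.alive q → I.alive p → I.pos q < I.pos p → I.adj q p →
    ∃ s < I.K, I.use q s ∧ I.use p s ∧ ∀ e < I.n, I.alive e → I.use e s →
      I.pos q < I.pos e → I.pos e < I.pos p → ¬ I.adj q e → I.adj e p

variable (I : SlotSystem)

/-- A state fits a vertex: the vertex is alive and not adjacent to any vertex which the state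
remembers for one of its slots. -/
def Fits (σ i : ℕ) : Prop :=
  I.alive i ∧ ∀ s < I.K, ¬ (0 < digit (I.n + 1) σ s ∧ I.use i s ∧ I.adj (digit (I.n + 1) σ s - 1) i)

open Classical in
/-- The digits of the state after taking the vertex `i`. -/
noncomputable def nextDigit (σ i s : ℕ) : ℕ :=
  if I.use i s then i + 1 else digit (I.n + 1) σ s

/-- The state after taking the vertex `i`. -/
noncomputable def next (σ i : ℕ) : ℕ :=
  horner (I.n + 1) (I.nextDigit σ i) I.K I.K

open Classical in
/-- The largest number of vertices that can be taken among the last `r` ones, from a state. -/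
noncomputable def value : ℕ → ℕ → ℕ
  | 0, _ => 0
  | r + 1, σ =>
    if I.Fits σ (I.ord (I.n - 1 - r)) ∧
        value r σ < value r (I.next σ (I.ord (I.n - 1 - r))) + 1 then
      value r (I.next σ (I.ord (I.n - 1 - r))) + 1
    else value r σ

open Classical in
theorem value_succ (r σ : ℕ) : I.value (r + 1) σ =
    if I.Fits σ (I.ord (I.n - 1 - r)) ∧
        I.value r σ < I.value r (I.next σ (I.ord (I.n - 1 - r))) + 1 then
      I.value r (I.next σ (I.ord (I.n - 1 - r))) + 1
    else I.value r σ := rfl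

/-- Independent sets of alive vertices. -/
def Indep (T : Finset ℕ) : Prop :=
  ∀ q ∈ T, q < I.n ∧ I.alive q ∧ ∀ e ∈ T, q ≠ e → ¬ I.adj q e

/-- The state remembers, for each slot, the last vertex of the set that uses it. -/
def Represents (σ : ℕ) (T : Finset ℕ) : Prop :=
  ∀ s < I.K, (digit (I.n + 1) σ s = 0 ∧ ∀ q ∈ T, ¬ I.use q s) ∨
    ∃ e ∈ T, digit (I.n + 1) σ s = e + 1 ∧ I.use e s ∧ ∀ q ∈ T, I.use q s → I.pos q ≤ I.pos e

variable {I}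

theorem nextDigit_lt {σ i : ℕ} (hi : i < I.n) (s : ℕ) : I.nextDigit σ i s < I.n + 1 := by
  unfold nextDigit
  split
  · omega
  · exact Nat.mod_lt _ (by omega)

theorem next_lt {σ i : ℕ} (hi : i < I.n) : I.next σ i < (I.n + 1) ^ I.K :=
  horner_lt (fun s _ => nextDigit_lt hi s) le_rfl

theorem digit_next {σ i s : ℕ} (hi : i < I.n) (hs : s < I.K) :
    digit (I.n + 1) (I.next σ i) s = I.nextDigit σ i s := by
  rw [next, digit_horner (fun s _ => nextDigit_lt hi s) le_rfl hs, Nat.sub_self, zero_add]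

theorem represents_zero : I.Represents 0 ∅ := fun s _ => .inl (by simp [digit])

theorem Indep.subset {S T : Finset ℕ} (h : I.Indep T) (hS : S ⊆ T) : I.Indep S :=
  fun q hq => ⟨(h q (hS hq)).1, (h q (hS hq)).2.1, fun e he => (h q (hS hq)).2.2 e (hS he)⟩

theorem Represents.insert {σ i : ℕ} {T : Finset ℕ} (h : I.Represents σ T) (hi : i < I.n)
    (hT : ∀ q ∈ T, I.pos q < I.pos i) : I.Represents (I.next σ i) (insert i T) := by
  intro s hs
  rw [digit_next hi hs, nextDigit]
  split_ifs with hu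
  · refine .inr ⟨i, Finset.mem_insert_self _ _, rfl, hu, fun q hq _ => ?_⟩
    rcases Finset.mem_insert.1 hq with rfl | hq
    · exact le_rfl
    · exact (hT q hq).le
  · rcases h s hs with ⟨h0, h1⟩ | ⟨e, he, h1, h2, h3⟩
    · refine .inl ⟨h0, fun q hq => ?_⟩
      rcases Finset.mem_insert.1 hq with rfl | hq
      · exact hu
      · exact h1 q hq
    · refine .inr ⟨e, Finset.mem_insert_of_mem he, h1, h2, fun q hq hqu => ?_⟩
      rcases Finset.mem_insert.1 hq with rfl | hq
      · exact absurd hqu hu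
      · exact h3 q hq hqu

/-- If a chosen q conflicted with i, take the slot supplied by `Valid.slot` and the vertex e
remembered there. Either e = q, or e lies between q and i and is not adjacent to q, hence is
adjacent to i. Both contradict `Fits`. -/
theorem Valid.indep_insert (hI : I.Valid) {σ i : ℕ} {T : Finset ℕ} (h : I.Represents σ T)
    (hT : I.Indep T) (hi : i < I.n) (hlt : ∀ q ∈ T, I.pos q < I.pos i) (hf : I.Fits σ i) :
    I.Indep (insert i T) := by
  have key : ∀ q ∈ T, ¬ I.adj q i := by
    intro q hq hadj
    obtain ⟨s, hs, hus, hui, hall⟩ :=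
      hI.slot q (hT q hq).1 i hi (hT q hq).2.1 hf.1 (hlt q hq) hadj
    rcases h s hs with ⟨_, h1⟩ | ⟨e, he, h1, h2, h3⟩
    · exact h1 q hq hus
    · have hei : ¬ I.adj e i := fun hadj' => hf.2 s hs ⟨by omega, hui, by simpa [h1] using hadj'⟩
      by_cases hqe : q = e
      · exact hei (hqe ▸ hadj)
      · have hne : I.pos q ≠ I.pos e := fun h' => hqe (by
          rw [← hI.ord_pos q (hT q hq).1, h', hI.ord_pos e (hT e he).1])
        exact hei (hall e (hT e he).1 (hT e he).2.1 h2 (by have := h3 q hq hus; omega)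
          (hlt e he) ((hT q hq).2.2 e he hqe))
  intro q hq
  rcases Finset.mem_insert.1 hq with rfl | hq
  · refine ⟨hi, hf.1, fun e he hne hadj => ?_⟩
    rcases Finset.mem_insert.1 he with rfl | he
    · exact hne rfl
    · exact key e he (hI.symm _ _ hadj)
  · refine ⟨(hT q hq).1, (hT q hq).2.1, fun e he hne hadj => ?_⟩
    rcases Finset.mem_insert.1 he with he | he
    · exact key q hq (he ▸ hadj)
    · exact (hT q hq).2.2 e he hne hadj

/-- This direction needs no validity: a remembered vertex is a chosen one. -/
theorem fits_of_indep_insert {σ i : ℕ} {T : Finset ℕ} (h : I.Represents σ T)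
    (hlt : ∀ q ∈ T, I.pos q < I.pos i) (hT : I.Indep (insert i T)) : I.Fits σ i := by
  refine ⟨(hT i (Finset.mem_insert_self _ _)).2.1, fun s hs hc => ?_⟩
  rcases h s hs with ⟨h0, _⟩ | ⟨e, he, h1, h2, h3⟩
  · omega
  · refine (hT e (Finset.mem_insert_of_mem he)).2.2 i (Finset.mem_insert_self _ _) ?_ ?_
    · rintro rfl; exact lt_irrefl _ (hlt e he)
    · simpa [h1] using hc.2.2

/-- The value is an upper bound. -/
theorem Valid.card_le_value (hI : I.Valid) {r : ℕ} (hr : r ≤ I.n) {σ : ℕ} {T S : Finset ℕ}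
    (h : I.Represents σ T) (hT : ∀ q ∈ T, I.pos q < I.n - r) (hS : ∀ q ∈ S, I.n - r ≤ I.pos q)
    (hTS : I.Indep (T ∪ S)) : S.card ≤ I.value r σ := by
  induction r generalizing σ T S with
  | zero =>
    have : S = ∅ := Finset.eq_empty_of_forall_notMem fun q hq => by
      have h1 := hS q hq
      have h2 := hI.pos_lt q (hTS q (Finset.mem_union_right _ hq)).1
      omega
    simp [this]
  | succ r ih =>
    set i := I.ord (I.n - 1 - r) with hi
    have hin : i < I.n := hI.ord_lt _ (by omega)
    have hpos : I.pos i = I.n - 1 - r := hI.pos_ord _ (by omega)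
    have hlt : ∀ q ∈ T, I.pos q < I.pos i := fun q hq => by have := hT q hq; omega
    rw [value_succ, ← hi]
    -- If the competing set contains the next vertex, independence shows that it fits, and taking it
    -- is one of the options compared by `value`; otherwise skipping it loses nothing.
    by_cases hiS : i ∈ S
    · have hfit : I.Fits σ i := fits_of_indep_insert h hlt (hTS.subset (by
        intro q hq
        rcases Finset.mem_insert.1 hq with rfl | hq
        · exact Finset.mem_union_right _ hiS
        · exact Finset.mem_union_left _ hq))
      have h1 : (S.erase i).card ≤ I.value r (I.next σ i) := by
        refine ih (by omega) (h.insert hin hlt) ?_ ?_ (hTS.subset ?_)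
        · intro q hq
          rcases Finset.mem_insert.1 hq with rfl | hq
          · omega
          · have := hT q hq; omega
        · intro q hq
          have h1 := hS q (Finset.mem_of_mem_erase hq)
          have h2 : I.pos q ≠ I.n - 1 - r := fun h' => Finset.ne_of_mem_erase hq (by
            rw [hi, ← h', hI.ord_pos q (hTS q (Finset.mem_union_right _
              (Finset.mem_of_mem_erase hq))).1])
          omega
        · intro q hq
          simp only [Finset.mem_union, Finset.mem_insert, Finset.mem_erase] at hq ⊢
          rcases hq with (rfl | hq) | hq
          · exact .inr hiS
          · exact .inl hq
          · exact .inr hq.2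
      have h2 := Finset.card_erase_add_one hiS
      split_ifs with hc
      · omega
      · simp only [hfit, true_and] at hc; omega
    · have h1 : S.card ≤ I.value r σ := by
        refine ih (by omega) h (fun q hq => by have := hT q hq; omega) (fun q hq => ?_) hTS
        have h1 := hS q hq
        have h2 : I.pos q ≠ I.n - 1 - r := fun h' => hiS (by
          rw [hi, ← h', hI.ord_pos q (hTS q (Finset.mem_union_right _ hq)).1]; exact hq)
        omega
      split_ifs with hc <;> omega

/-- Only the upper bound is proved here; that the value is attained comes from the program which
reads off a solution. -/
theorem Valid.card_le_value_zero (hI : I.Valid) {S : Finset ℕ} (hS : I.Indep S) :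
    S.card ≤ I.value I.n 0 :=
  hI.card_le_value le_rfl represents_zero (by simp) (by simp) (by simpa using hS)

end SlotSystem

section

/-! ### Sharing an edge, in coordinates -/

/-- Two paths have a horizontal or a vertical grid edge in common. -/
def OneBendPath.Meets (P Q : OneBendPath) : Prop :=
  (P.cy = Q.cy ∧
    max (min P.cx P.hx) (min Q.cx Q.hx) < min (max P.cx P.hx) (max Q.cx Q.hx)) ∨
  (P.cx = Q.cx ∧
    max (min P.cy P.vy) (min Q.cy Q.vy) < min (max P.cy P.vy) (max Q.cy Q.vy))

theorem OneBendPath.Meets.symm {P Q : OneBendPath} (h : P.Meets Q) : Q.Meets P := by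
  unfold OneBendPath.Meets at *; omega

/-- Horizontal and vertical edges never coincide, so a common edge reduces to the overlap of two
intervals on one line. The witness is the first common edge, at the larger of the two lower ends. -/
theorem OneBendPath.edges_inter_nonempty {P Q : OneBendPath} :
    (P.edges ∩ Q.edges).Nonempty ↔ P.Meets Q := by
  constructor
  · rintro ⟨e, h1 | h1, h2 | h2⟩ <;> obtain ⟨x, hx1, hx2, rfl⟩ := h1 <;>
      obtain ⟨y, hy1, hy2, h⟩ := h2 <;>
      simp only [Sym2.eq_iff, Prod.mk.injEq] at h <;> unfold OneBendPath.Meets <;> omega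
  · rintro (⟨h1, h2⟩ | ⟨h1, h2⟩)
    · refine ⟨_, .inl ⟨max (min P.cx P.hx) (min Q.cx Q.hx), by omega, by omega, rfl⟩,
        .inl ⟨max (min P.cx P.hx) (min Q.cx Q.hx), by omega, by omega, by rw [h1]⟩⟩
    · refine ⟨_, .inr ⟨max (min P.cy P.vy) (min Q.cy Q.vy), by omega, by omega, rfl⟩,
        .inr ⟨max (min P.cy P.vy) (min Q.cy Q.vy), by omega, by omega, by rw [h1]⟩⟩

/-! ### Compression of the columns -/

/-- The columns of the corners, followed by the columns of the ends of the horizontal parts. -/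
def endpoint (n : ℕ) (p : ℕ → OneBendPath) (j : ℕ) : ℕ :=
  if j < n then (p j).cx else (p (j - n)).hx

/-- The number of endpoint columns to the left of column `x`, among the first `m` ones. -/
def rankAmong (n : ℕ) (p : ℕ → OneBendPath) (m x : ℕ) : ℕ :=
  (((Finset.range m).image (endpoint n p)).filter (· < x)).card

/-- The number of endpoint columns to the left of column `x`. -/
def columnRank (n : ℕ) (p : ℕ → OneBendPath) (x : ℕ) : ℕ := rankAmong n p (n + n) x

variable {n : ℕ} {p : ℕ → OneBendPath}

theorem columnRank_le (x : ℕ) : columnRank n p x ≤ n + n :=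
  (Finset.card_filter_le _ _).trans (Finset.card_image_le.trans (Finset.card_range _).le)

theorem columnRank_mono {a b : ℕ} (h : a ≤ b) : columnRank n p a ≤ columnRank n p b := by
  unfold columnRank rankAmong
  refine Finset.card_le_card fun x hx => ?_
  rw [Finset.mem_filter] at hx ⊢
  exact ⟨hx.1, by omega⟩

/-- The endpoint column a is itself counted for b, but not for a. -/
theorem columnRank_strict {a b j : ℕ} (hj : j < n + n) (ha : endpoint n p j = a) (h : a < b) :
    columnRank n p a < columnRank n p b := by
  unfold columnRank rankAmong
  refine Finset.card_lt_card (Finset.ssubset_iff_of_subset ?_ |>.2 ⟨a, ?_, ?_⟩)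
  · intro x hx
    rw [Finset.mem_filter] at hx ⊢
    exact ⟨hx.1, by omega⟩
  · exact Finset.mem_filter.2 ⟨Finset.mem_image.2 ⟨j, by simpa using hj, ha⟩, h⟩
  · simp

/-- At most b - a endpoint columns lie in [a, b). Hence the bound c on horizontal lengths survives
compression. -/
theorem columnRank_le_add (a b : ℕ) :
    columnRank n p b ≤ columnRank n p a + (b - a) := by
  have : ((Finset.range (n + n)).image (endpoint n p)).filter (· < b) ⊆
      ((Finset.range (n + n)).image (endpoint n p)).filter (· < a) ∪ Finset.Ico a b := by
    intro x hx
    simp only [Finset.mem_union, Finset.mem_filter, Finset.mem_Ico] at hx ⊢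
    by_cases hxa : x < a
    · exact .inl ⟨hx.1, hxa⟩
    · exact .inr ⟨by omega, hx.2⟩
  refine (Finset.card_le_card this).trans ((Finset.card_union_le _ _).trans ?_)
  simp [columnRank, rankAmong]

theorem columnRank_lt_cx {i y : ℕ} (hi : i < n) (h : (p i).cx < y) :
    columnRank n p (p i).cx < columnRank n p y :=
  columnRank_strict (j := i) (by omega) (by simp [endpoint, hi]) h

theorem columnRank_lt_hx {i y : ℕ} (hi : i < n) (h : (p i).hx < y) :
    columnRank n p (p i).hx < columnRank n p y :=
  columnRank_strict (j := i + n) (by omega) (by simp [endpoint]) h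

/-! ### The instance of a shift -/

section Shift

variable (n : ℕ) (k j : ℕ) (p : ℕ → OneBendPath)

/-- The shifted rank of the column of the vertical part. -/
def cornerCol (i : ℕ) : ℕ := columnRank n p (p i).cx + j
/-- The shifted rank of the column of the end of the horizontal part. -/
def endCol (i : ℕ) : ℕ := columnRank n p (p i).hx + j
/-- The height of the corner; among paths of equal height those going down come first. -/
def height (i : ℕ) : ℕ := (p i).cy + (p i).cy + if (p i).cy < (p i).vy then 1 else 0

/-- The linear order: by slabs of `k` columns, then by height. -/
def Before (i' i : ℕ) : Prop :=
  cornerCol n j p i' / k < cornerCol n j p i / k ∨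
    (cornerCol n j p i' / k = cornerCol n j p i / k ∧
      (height p i' < height p i ∨ (height p i' = height p i ∧ i' < i)))

instance (i' i : ℕ) : Decidable (Before n k j p i' i) := by unfold Before; infer_instance

/-- The position in the linear order. -/
def position (i : ℕ) : ℕ := ((Finset.range n).filter (Before n k j p · i)).card

/-- The paths that stay in a slab, with a slot for each column and each gap between columns of
a slab. -/
noncomputable def shiftSystem : SlotSystem where
  n := n
  K := k + k
  alive i := cornerCol n j p i / k = endCol n j p i / k
  use i s := (cornerCol n j p i % k = s ∧ ¬ (p i).cy = (p i).vy) ∨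
    (k + min (cornerCol n j p i % k) (endCol n j p i % k) ≤ s ∧
      s < k + max (cornerCol n j p i % k) (endCol n j p i % k))
  adj i i' := (p i).Meets (p i')
  pos := position n k j p
  ord := Function.invFunOn (position n k j p) (Set.Iio n)

/-! ### Slabs, the linear order, and validity of the shift system -/

variable {n k j p}

/-- Division by k is monotone, so whatever lies between two columns of a slab lies in that slab, and
there offsets are ordered as the columns are. -/
theorem mod_between {x y g : ℕ} (h : x / k = y / k) (h1 : min x y ≤ g) (h2 : g < max x y) :
    g / k = x / k ∧ min (x % k) (y % k) ≤ g % k ∧ g % k < max (x % k) (y % k) := by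
  have hg : g / k = x / k := by
    have h3 := Nat.div_le_div_right (c := k) h1
    have h4 := Nat.div_le_div_right (c := k) h2.le
    rcases le_total x y with h5 | h5
    · rw [min_eq_left h5] at h3; rw [max_eq_right h5] at h4; omega
    · rw [min_eq_right h5] at h3; rw [max_eq_left h5] at h4; omega
  have hx := Nat.div_add_mod x k
  have hy := Nat.div_add_mod y k
  have hg' := Nat.div_add_mod g k
  rw [hg] at hg'
  rw [← h] at hy
  exact ⟨hg, by omega, by omega⟩

theorem between_of_mod {x y g : ℕ} (h : x / k = y / k) (hg : g / k = x / k)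
    (h1 : min (x % k) (y % k) ≤ g % k) (h2 : g % k < max (x % k) (y % k)) :
    min x y ≤ g ∧ g < max x y := by
  have hx := Nat.div_add_mod x k
  have hy := Nat.div_add_mod y k
  have hg' := Nat.div_add_mod g k
  rw [hg] at hg'
  rw [← h] at hy
  exact ⟨by omega, by omega⟩

/-- By transitivity the predecessors of a precede b, and a itself is a further predecessor of b. -/
theorem position_lt_of_before {a b : ℕ} (ha : a < n) (h : Before n k j p a b) :
    position n k j p a < position n k j p b := by
  refine Finset.card_lt_card (Finset.ssubset_iff_of_subset ?_ |>.2 ⟨a, ?_, ?_⟩)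
  · intro x hx
    simp only [Finset.mem_filter] at hx ⊢
    refine ⟨hx.1, ?_⟩
    unfold Before at *; omega
  · simpa [ha] using h
  · simp only [Finset.mem_filter, not_and]; unfold Before; omega

theorem before_of_position_lt {a b : ℕ} (hb : b < n)
    (h : position n k j p a < position n k j p b) : Before n k j p a b := by
  by_contra hc
  by_cases hab : a = b
  · subst hab; omega
  · have : Before n k j p b a := by unfold Before at *; omega
    have := position_lt_of_before hb this
    omega

theorem position_lt {i : ℕ} (hi : i < n) : position n k j p i < n := by
  have : (Finset.range n).filter (Before n k j p · i) ⊂ Finset.range n := by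
    refine Finset.ssubset_iff_of_subset (Finset.filter_subset _ _) |>.2 ⟨i, by simpa using hi, ?_⟩
    simp only [Finset.mem_filter, not_and]; unfold Before; omega
  simpa [position] using Finset.card_lt_card this

theorem position_injOn : Set.InjOn (position n k j p) (Set.Iio n) := by
  intro a ha b hb h
  by_contra hab
  have : Before n k j p a b ∨ Before n k j p b a := by unfold Before; omega
  rcases this with h' | h'
  · have := position_lt_of_before ha h'; omega
  · have := position_lt_of_before hb h'; omega

theorem position_surj {q : ℕ} (hq : q < n) : ∃ i ∈ Set.Iio n, position n k j p i = q := by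
  have := Finset.surj_on_of_inj_on_of_card_le (s := Finset.range n) (t := Finset.range n)
    (fun i _ => position n k j p i) (fun i hi => by simpa using position_lt (by simpa using hi))
    (fun a b ha hb h => position_injOn (by simpa using ha) (by simpa using hb) h) le_rfl q
    (by simpa using hq)
  obtain ⟨i, hi, h⟩ := this
  exact ⟨i, by simpa using hi, h.symm⟩

theorem ord_position {i : ℕ} (hi : i < n) :
    (shiftSystem n k j p).ord (position n k j p i) = i :=
  position_injOn.leftInvOn_invFunOn hi

/-- The tie rule in `height` matters here: an upward path placed before a downward one with the same
corner row would violate the inequality. -/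
theorem min_lt_max_of_height_le {i i' : ℕ} (h : height p i ≤ height p i')
    (hi : (p i).cy ≠ (p i).vy) (hi' : (p i').cy ≠ (p i').vy) :
    min (p i).cy (p i).vy < max (p i').cy (p i').vy := by
  unfold height at h
  split_ifs at h <;> omega

/-- Ranks are monotone, and strictly so above an endpoint column. Only the smaller column has to be
an endpoint, so nothing is required of b. -/
theorem endpoint_lt_iff {a : ℕ} (ha : a < n) (b : ℕ) :
    ((p a).cx < (p b).cx ↔ cornerCol n j p a < cornerCol n j p b) ∧
    ((p a).cx < (p b).hx ↔ cornerCol n j p a < endCol n j p b) ∧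
    ((p a).hx < (p b).cx ↔ endCol n j p a < cornerCol n j p b) ∧
    ((p a).hx < (p b).hx ↔ endCol n j p a < endCol n j p b) := by
  have hmono : ∀ u v, u ≤ v → columnRank n p u + j ≤ columnRank n p v + j :=
    fun u v h => Nat.add_le_add_right (columnRank_mono h) _
  unfold cornerCol endCol
  refine ⟨⟨fun h => ?_, fun h => ?_⟩, ⟨fun h => ?_, fun h => ?_⟩, ⟨fun h => ?_, fun h => ?_⟩,
    ⟨fun h => ?_, fun h => ?_⟩⟩
  · have := columnRank_lt_cx ha h; omega
  · by_contra hc; have := hmono _ _ (not_lt.1 hc); omega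
  · have := columnRank_lt_cx ha h; omega
  · by_contra hc; have := hmono _ _ (not_lt.1 hc); omega
  · have := columnRank_lt_hx ha h; omega
  · by_contra hc; have := hmono _ _ (not_lt.1 hc); omega
  · have := columnRank_lt_hx ha h; omega
  · by_contra hc; have := hmono _ _ (not_lt.1 hc); omega

/-- Overlap is a Boolean combination of strict comparisons between ends, and ranks preserve each of
them. -/
theorem overlap_iff {a b : ℕ} (ha : a < n) (hb : b < n) :
    max (min (p a).cx (p a).hx) (min (p b).cx (p b).hx) <
        min (max (p a).cx (p a).hx) (max (p b).cx (p b).hx) ↔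
      max (min (cornerCol n j p a) (endCol n j p a)) (min (cornerCol n j p b) (endCol n j p b)) <
        min (max (cornerCol n j p a) (endCol n j p a))
          (max (cornerCol n j p b) (endCol n j p b)) := by
  have h1 := endpoint_lt_iff (j := j) (p := p) ha b
  have h2 := endpoint_lt_iff (j := j) (p := p) hb a
  have h3 := endpoint_lt_iff (j := j) (p := p) ha a
  have h4 := endpoint_lt_iff (j := j) (p := p) hb b
  simp only [max_lt_iff, lt_min_iff, min_lt_iff, lt_max_iff, h1.1, h1.2.1, h1.2.2.1, h1.2.2.2,
    h2.1, h2.2.1, h2.2.2.1, h2.2.2.2, h3.1, h3.2.1, h3.2.2.1, h3.2.2.2, h4.1, h4.2.1, h4.2.2.1,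
    h4.2.2.2]

/-- The common slot is a shared gap if the two paths share a horizontal edge, and their common
column if they share a vertical one. In both cases the two paths are in the same slab, hence so is
every path between them in the order. -/
theorem shiftSystem_valid (hk : 0 < k) : (shiftSystem n k j p).Valid where
  pos_lt i hi := position_lt hi
  ord_lt q hq := Function.invFunOn_mem (position_surj hq)
  pos_ord q hq := Function.invFunOn_eq (position_surj hq)
  ord_pos i hi := ord_position hi
  symm _ _ h := h.symm
  slot := by
    intro q hq r hr haq har hqr hadj
    have hbqr := before_of_position_lt hr hqr
    have ebefore : ∀ e < n, position n k j p q < position n k j p e →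
        position n k j p e < position n k j p r → Before n k j p q e ∧ Before n k j p e r :=
      fun e he h1 h2 => ⟨before_of_position_lt he h1, before_of_position_lt hr h2⟩
    simp only [shiftSystem] at haq har hadj hq hr ⊢
    have hcx : ∀ a < n, ∀ b < n, cornerCol n j p a = cornerCol n j p b → (p a).cx = (p b).cx := by
      intro a ha b hb h
      by_contra hne
      unfold cornerCol at h
      rcases Nat.lt_or_gt_of_ne hne with h' | h'
      · have := columnRank_lt_cx ha h'; omega
      · have := columnRank_lt_cx hb h'; omega
    have hmk : ∀ x, x % k < k := fun x => Nat.mod_lt x hk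
    have hdm : ∀ x y, x / k = y / k → x % k = y % k → x = y := fun x y h1 h2 => by
      rw [← Nat.div_add_mod x k, ← Nat.div_add_mod y k, h1, h2]
    rcases hadj with ⟨hcy, hov⟩ | ⟨hcxeq, hov⟩
    · rw [overlap_iff (j := j) hq hr] at hov
      -- The leftmost gap common to both horizontal parts; its offset determines the slot.
      obtain ⟨g, hg1, hg2, hg3, hg4⟩ : ∃ g, min (cornerCol n j p q) (endCol n j p q) ≤ g ∧
          g < max (cornerCol n j p q) (endCol n j p q) ∧
          min (cornerCol n j p r) (endCol n j p r) ≤ g ∧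
          g < max (cornerCol n j p r) (endCol n j p r) :=
        ⟨max (min (cornerCol n j p q) (endCol n j p q)) (min (cornerCol n j p r) (endCol n j p r)),
          by omega, by omega, by omega, by omega⟩
      obtain ⟨hgq, hq1, hq2⟩ := mod_between haq hg1 hg2
      obtain ⟨hgr, hr1, hr2⟩ := mod_between har hg3 hg4
      refine ⟨k + g % k, by have := hmk g; omega, .inr ⟨by omega, by omega⟩,
        .inr ⟨by omega, by omega⟩, ?_⟩
      intro e he hae hue h1 h2 _
      obtain ⟨hb1, hb2⟩ := ebefore e he h1 h2
      have hslab : cornerCol n j p e / k = cornerCol n j p q / k := by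
        unfold Before at hb1 hb2; omega
      rcases hue with ⟨hue1, hue2⟩ | ⟨hue1, hue2⟩
      · have := hmk (cornerCol n j p e); omega
      · obtain ⟨h3, h4⟩ := between_of_mod hae (hgq.trans hslab.symm) (by omega) (by omega)
        refine .inl ⟨?_, (overlap_iff (j := j) he hr).2
          (max_lt (lt_min ?_ ?_) (lt_min ?_ ?_))⟩
        -- With y the common row, the heights of q and r are 2y or 2y + 1. The height of e lies
        -- between them, so its corner is in row y too.
        · unfold Before height at hb1 hb2
          clear hov hg1 hg2 hg3 hg4 h3 h4 hue1 hue2 hq1 hq2 hr1 hr2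
          split_ifs at hb1 hb2 <;> omega
        all_goals clear hov hq1 hq2 hr1 hr2 hue1 hue2 hg1 hg2; omega
    · have hcol : cornerCol n j p q = cornerCol n j p r := by unfold cornerCol; rw [hcxeq]
      refine ⟨cornerCol n j p q % k, by have := hmk (cornerCol n j p q); omega,
        .inl ⟨rfl, by omega⟩, .inl ⟨by rw [hcol], by omega⟩, ?_⟩
      intro e he hae hue h1 h2 hnadj
      obtain ⟨hb1, hb2⟩ := ebefore e he h1 h2
      have hslab : cornerCol n j p e / k = cornerCol n j p q / k := by
        unfold Before at hb1 hb2; rw [← hcol] at hb2; omega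
      rcases hue with ⟨hue1, hue2⟩ | ⟨hue1, hue2⟩
      · have h3 := hcx e he q hq (hdm _ _ hslab hue1)
        unfold Before at hb1 hb2
        rw [← hcol] at hb2
        have hqe : height p q ≤ height p e := by clear hov hb2; omega
        have her : height p e ≤ height p r := by clear hov hb1; omega
        have hq' : (p q).cy ≠ (p q).vy := by clear hb1 hb2; omega
        have hr' : (p r).cy ≠ (p r).vy := by clear hb1 hb2; omega
        clear hb1 hb2
        have h4 := min_lt_max_of_height_le (p := p) hqe hq' hue2
        have h5 := min_lt_max_of_height_le (p := p) her hue2 hr'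
        -- Disjoint from q, and by the order of heights not below it, the vertical part of e lies
        -- above that of q.
        have h6 : max (p q).cy (p q).vy ≤ min (p e).cy (p e).vy := by
          unfold OneBendPath.Meets at hnadj
          by_contra hc
          refine hnadj (.inr ⟨h3.symm, max_lt (lt_min ?_ h4) (lt_min (by omega) ?_)⟩) <;> omega
        -- As r overlaps q, its lower end is below the top of q, hence below e; the order of heights
        -- puts its upper end above the lower end of e.
        refine .inr ⟨h3.trans hcxeq, max_lt (lt_min ?_ h5) (lt_min ?_ ?_)⟩ <;> omega
      · have := hmk (cornerCol n j p q); omega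

/-! ### Averaging over the shifts -/

/-- Neighbouring columns b and b + 1 are separated only by a shift j with k ∣ b + j + 1, and at most
one such j is below k. Summation over the b - a gaps is the induction. -/
theorem card_shift_cut {a b : ℕ} (h : a ≤ b) :
    ((Finset.range k).filter fun j => (a + j) / k ≠ (b + j) / k).card ≤ b - a := by
  induction b, h using Nat.le_induction with
  | base => simp
  | succ b h ih =>
    have hsub : ((Finset.range k).filter fun j => (a + j) / k ≠ (b + 1 + j) / k) ⊆
        ((Finset.range k).filter fun j => (a + j) / k ≠ (b + j) / k) ∪
          ((Finset.range k).filter fun j => k ∣ b + j + 1) := by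
      intro j hj
      simp only [Finset.mem_union, Finset.mem_filter] at hj ⊢
      by_cases hd : k ∣ b + j + 1
      · exact .inr ⟨hj.1, hd⟩
      · refine .inl ⟨hj.1, fun heq => hj.2 ?_⟩
        rw [heq, show b + 1 + j = b + j + 1 by ring, Nat.succ_div_of_not_dvd hd]
    -- Two such shifts differ by a multiple of k, and both are below k.
    have hone : ((Finset.range k).filter fun j => k ∣ b + j + 1).card ≤ 1 := by
      refine Finset.card_le_one.2 fun x hx y hy => ?_
      simp only [Finset.mem_filter, Finset.mem_range] at hx hy
      have key : ∀ x y, x < k → y < k → x ≤ y → k ∣ b + x + 1 → k ∣ b + y + 1 → x = y := by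
        intro x y _ hy hxy h1 h2
        have := (Nat.dvd_sub h2 h1)
        rw [show b + y + 1 - (b + x + 1) = y - x by omega] at this
        have := Nat.eq_zero_of_dvd_of_lt this (by omega)
        omega
      rcases le_total x y with hxy | hxy
      · exact key x y hx.1 hy.1 hxy hx.2 hy.2
      · exact (key y x hy.1 hx.1 hxy hy.2 hx.2).symm
    have := Finset.card_le_card hsub
    have := Finset.card_union_le ((Finset.range k).filter fun j => (a + j) / k ≠ (b + j) / k)
      ((Finset.range k).filter fun j => k ∣ b + j + 1)
    omega

theorem card_cut_le (i : ℕ) :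
    ((Finset.range k).filter fun j => cornerCol n j p i / k ≠ endCol n j p i / k).card ≤
      (p i).horLength := by
  unfold cornerCol endCol OneBendPath.horLength
  rcases le_total (p i).cx (p i).hx with h | h
  · refine (card_shift_cut (columnRank_mono h)).trans ?_
    have := columnRank_le_add (n := n) (p := p) (p i).cx (p i).hx
    omega
  · simp only [ne_comm (a := (columnRank n p (p i).cx + _) / k)]
    refine (card_shift_cut (columnRank_mono h)).trans ?_
    have := columnRank_le_add (n := n) (p := p) (p i).hx (p i).cx
    omega

/-- Some shift cuts only a small part of a given set of paths. -/
theorem exists_shift (hk : 0 < k) {c : ℕ} {S : Finset ℕ} (hc : ∀ i ∈ S, (p i).horLength ≤ c) :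
    ∃ j < k, k * (S.filter fun i => cornerCol n j p i / k ≠ endCol n j p i / k).card ≤
      c * S.card := by
  have hsum : ∑ j ∈ Finset.range k,
      (S.filter fun i => cornerCol n j p i / k ≠ endCol n j p i / k).card ≤ c * S.card := by
    simp only [Finset.card_filter]
    -- Double counting: each path of the set is cut by at most c shifts.
    rw [Finset.sum_comm]
    refine (Finset.sum_le_card_nsmul _ _ c fun i hi => ?_).trans (by rw [smul_eq_mul, mul_comm])
    rw [← Finset.card_filter]
    exact (card_cut_le i).trans (hc i hi)
  by_contra! hcon
  have h1 : ∑ j ∈ Finset.range k, c * S.card < ∑ j ∈ Finset.range k,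
      k * (S.filter fun i => cornerCol n j p i / k ≠ endCol n j p i / k).card :=
    Finset.sum_lt_sum_of_nonempty (by simpa using hk.ne') fun j hj => hcon j (by simpa using hj)
  rw [Finset.sum_const, ← Finset.mul_sum, Finset.card_range, smul_eq_mul] at h1
  exact absurd (Nat.mul_le_mul_left k hsum) (by omega)

end Shift

end

/-! ### Building blocks of the program -/

namespace LoopProgram

@[simp] theorem exec_skip (s : Store) : skip.exec s = s := rfl
@[simp] theorem exec_assign (r : ℕ) (e : Expr) (s : Store) :
    (assign r e).exec s = s.setReg r (e.eval s) := rfl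
@[simp] theorem exec_write (a : ℕ) (e₁ e₂ : Expr) (s : Store) :
    (write a e₁ e₂).exec s = s.setArr a (e₁.eval s) (e₂.eval s) := rfl
@[simp] theorem exec_seq (p q : LoopProgram) (s : Store) :
    (seq p q).exec s = q.exec (p.exec s) := rfl
@[simp] theorem exec_ifLt (e₁ e₂ : Expr) (p q : LoopProgram) (s : Store) :
    (ifLt e₁ e₂ p q).exec s = if e₁.eval s < e₂.eval s then p.exec s else q.exec s := rfl

theorem exec_ifPos (e : Expr) (p q : LoopProgram) (s : Store) :
    (ifLt (.const 0) e p q).exec s = if 0 < e.eval s then p.exec s else q.exec s := by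
  rw [exec_ifLt]; congr 1

end LoopProgram

open LoopProgram

/-- Negation. -/
def Expr.not (x : Expr) : Expr := .sub (.const 1) x

@[simp] theorem Expr.not_pos (s : Store) (x : Expr) :
    0 < (Expr.not x).eval s ↔ ¬ 0 < x.eval s := by
  simp only [Expr.not, Expr.eval_sub, Expr.eval_const]; omega

/-- Add the product of the registers `3` and `20` to the register `21`. -/
def addProduct : LoopProgram := .loop 11 3 (.assign 21 (.add (.reg 21) (.reg 20)))

theorem addProduct_reg (s : Store) :
    (addProduct.exec s).reg 21 = s.reg 21 + s.reg 3 * s.reg 20 := by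
  refine exec_loop rfl (fun m s' => s'.reg 21 = s.reg 21 + m * s.reg 20) (by simp) ?_
  intro m s' _ _ hreg _ hQ
  have := hreg 20 (by decide) rfl
  simp [hQ, this]; ring

/-- Compute the power of the register `3` with the exponent in the register `2`. -/
def powerProgram : LoopProgram :=
  .seq (.assign 20 (.const 1)) (.loop 10 2
    (.seq (.assign 21 (.const 0)) (.seq addProduct (.assign 20 (.reg 21)))))

theorem powerProgram_reg (s : Store) :
    (powerProgram.exec s).reg 20 = s.reg 3 ^ s.reg 2 := by
  rw [powerProgram, exec_seq, exec_assign]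
  have h2 : (s.setReg 20 ((Expr.const 1).eval s)).reg 2 = s.reg 2 := by simp
  have h3 : (s.setReg 20 ((Expr.const 1).eval s)).reg 3 = s.reg 3 := by simp
  rw [← h2]
  refine exec_loop rfl (fun m s' => s'.reg 20 = s.reg 3 ^ m) (by simp) ?_
  intro m s' _ _ hreg _ hQ
  have := hreg 3 (by decide) rfl
  simp [addProduct_reg, hQ, this, pow_succ, mul_comm]

/-- Fill the arrays `m` and `d` with the remainders and the quotients of the numbers from the value
of `e` on, divided by the register `b`. -/
def divTable (m d l b : ℕ) (e : Expr) : LoopProgram :=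
  .seq (.write m (.const 0) e) (.seq (.write d (.const 0) (.const 0)) (.loop 10 l
    (.ifLt (.add (.read m (.reg 10)) (.const 1)) (.reg b)
      (.seq (.write m (.add (.reg 10) (.const 1)) (.add (.read m (.reg 10)) (.const 1)))
        (.write d (.add (.reg 10) (.const 1)) (.read d (.reg 10))))
      (.seq (.write m (.add (.reg 10) (.const 1)) (.const 0))
        (.write d (.add (.reg 10) (.const 1)) (.add (.read d (.reg 10)) (.const 1)))))))

/-- The start value is below the divisor, so its remainder is itself and its quotient 0. Each
further entry either increments the remainder or resets it and carries into the quotient. -/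
theorem divTable_arr {m d l b : ℕ} {e : Expr} {s : Store} (hmd : m ≠ d) (hb : b ≠ 10)
    (he : e.eval s < s.reg b) : ∀ x ≤ s.reg l,
      ((divTable m d l b e).exec s).arr m x = (x + e.eval s) % s.reg b ∧
      ((divTable m d l b e).exec s).arr d x = (x + e.eval s) / s.reg b := by
  rw [divTable, exec_seq, exec_seq, exec_write, exec_write]
  set s₁ := (s.setArr m ((Expr.const 0).eval s) (e.eval s)) with hs₁
  refine exec_loop (m := s.reg l) (by rfl) (fun y s' => ∀ x ≤ y, s'.arr m x = (x + e.eval s) % s.reg b ∧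
      s'.arr d x = (x + e.eval s) / s.reg b) ?_ ?_
  · intro x hx
    obtain rfl : x = 0 := by omega
    simp [hs₁, hmd, Nat.mod_eq_of_lt he, Nat.div_eq_of_lt he]
  · intro y s' _ hy hreg _ hQ x hx
    have hb' : s'.reg b = s.reg b := hreg b hb (by simp [writesReg])
    obtain ⟨h1, h2⟩ := hQ y le_rfl
    have hdm := Nat.div_add_mod (y + e.eval s) (s.reg b)
    have hlt := Nat.mod_lt (y + e.eval s) (show 0 < s.reg b by omega)
    have key : (if (y + e.eval s) % s.reg b + 1 < s.reg b
        then (y + 1 + e.eval s) % s.reg b = (y + e.eval s) % s.reg b + 1 ∧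
          (y + 1 + e.eval s) / s.reg b = (y + e.eval s) / s.reg b
        else (y + 1 + e.eval s) % s.reg b = 0 ∧
          (y + 1 + e.eval s) / s.reg b = (y + e.eval s) / s.reg b + 1) := by
      split_ifs with hc
      · have := (Nat.div_mod_unique (a := y + 1 + e.eval s) (b := s.reg b)
          (c := (y + e.eval s) % s.reg b + 1) (d := (y + e.eval s) / s.reg b) (by omega)).2
          ⟨by omega, hc⟩
        exact ⟨this.2, this.1⟩
      · have := (Nat.div_mod_unique (a := y + 1 + e.eval s) (b := s.reg b)
          (c := 0) (d := (y + e.eval s) / s.reg b + 1) (by omega)).2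
          ⟨by rw [mul_add_one]; omega, by omega⟩
        exact ⟨this.2, this.1⟩
    simp only [exec_ifLt, Expr.eval_add, Expr.eval_read, Expr.eval_reg, Expr.eval_const, hy, hb',
      h1]
    split_ifs at key ⊢ with hc
    · rcases Nat.lt_or_ge y x with hxy | hxy
      · obtain rfl : x = y + 1 := by omega
        simp [hmd, hmd.symm, hy, h1, h2, key]
      · have : x ≠ y + 1 := by omega
        simp [this, hy, hQ x hxy]
    · rcases Nat.lt_or_ge y x with hxy | hxy
      · obtain rfl : x = y + 1 := by omega
        simp [hmd, hmd.symm, hy, h2, key]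
      · have : x ≠ y + 1 := by omega
        simp [this, hy, hQ x hxy]

/-- Fill the array `7` with the multiples of the register `3`. -/
def mulTable : LoopProgram :=
  .seq (.write 7 (.const 0) (.const 0)) (.loop 10 4
    (.write 7 (.add (.reg 10) (.const 1)) (.add (.read 7 (.reg 10)) (.reg 3))))

theorem mulTable_arr (s : Store) : ∀ x ≤ s.reg 4, (mulTable.exec s).arr 7 x = x * s.reg 3 := by
  rw [mulTable, exec_seq, exec_write]
  refine exec_loop (m := s.reg 4) (by rfl) (fun y s' => ∀ x ≤ y, s'.arr 7 x = x * s.reg 3) (fun x hx => by simp [Nat.le_zero.1 hx]) ?_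
  intro y s' _ hy hreg _ hQ x hx
  have h3 : s'.reg 3 = s.reg 3 := hreg 3 (by decide) rfl
  rcases Nat.lt_or_ge y x with hxy | hxy
  · obtain rfl : x = y + 1 := by omega
    simp [hy, h3, hQ y le_rfl, add_one_mul]
  · have : x ≠ y + 1 := by omega
    simp [this, hy, hQ x hxy]

/-- The paths in the arrays `0, 1, 2, 3`. -/
def Store.path (s : Store) (i : ℕ) : OneBendPath := ⟨s.arr 0 i, s.arr 1 i, s.arr 2 i, s.arr 3 i⟩

/-- Fill the array `8` with the endpoint columns. -/
def endpointProgram : LoopProgram :=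
  .loop 10 0 (.seq (.write 8 (.reg 10) (.read 0 (.reg 10)))
    (.write 8 (.add (.reg 10) (.reg 0)) (.read 2 (.reg 10))))

theorem endpointProgram_arr (s : Store) : ∀ x < s.reg 0 + s.reg 0,
    (endpointProgram.exec s).arr 8 x = endpoint (s.reg 0) s.path x := by
  have key : ∀ x < s.reg 0, (endpointProgram.exec s).arr 8 x = s.arr 0 x ∧
      (endpointProgram.exec s).arr 8 (x + s.reg 0) = s.arr 2 x := by
    refine exec_loop rfl (fun y s' => ∀ x < y, s'.arr 8 x = s.arr 0 x ∧
      s'.arr 8 (x + s.reg 0) = s.arr 2 x) (by simp) ?_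
    intro y s' hlt hy hreg harr hQ x hx
    have h0 : s'.reg 0 = s.reg 0 := hreg 0 (by decide) rfl
    have h1 : s'.arr 0 = s.arr 0 := harr 0 rfl
    have h2 : s'.arr 2 = s.arr 2 := harr 2 rfl
    rcases Nat.lt_or_ge x y with hxy | hxy
    · have e1 : x ≠ y + s.reg 0 := by omega
      have e2 : x ≠ y := by omega
      have e3 : x + s.reg 0 ≠ y := by omega
      simp [hy, h0, e1, e2, e3, hQ x hxy]
    · obtain rfl : x = y := by omega
      have e1 : s.reg 0 ≠ 0 := by omega
      simp only [exec_seq, exec_write, Store.setReg_arr, Store.setArr_arr, Expr.eval_add,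
        Expr.eval_read, Expr.eval_reg, Store.setArr_reg, hy, h0, h1, h2]
      simp [e1]
  intro x hx
  rcases Nat.lt_or_ge x (s.reg 0) with h | h
  · simp [endpoint, h, key x h, Store.path]
  · have := (key (x - s.reg 0) (by omega)).2
    rw [Nat.sub_add_cancel h] at this
    simp [endpoint, not_lt.2 h, this, Store.path]

/-- Add one to the counters of the endpoint columns to the right of a given endpoint column. -/
def countRight : LoopProgram :=
  .loop 11 5 (.write 10 (.reg 11)
    (.add (.read 10 (.reg 11)) (Expr.lt (.read 8 (.reg 10)) (.read 8 (.reg 11)))))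

theorem countRight_arr (s : Store) : ∀ x < s.reg 5, (countRight.exec s).arr 10 x =
    s.arr 10 x + if s.arr 8 (s.reg 10) < s.arr 8 x then 1 else 0 := by
  -- Stated for all x, so that entries not yet reached are known to be unchanged.
  have key : ∀ x, (countRight.exec s).arr 10 x =
      s.arr 10 x + if x < s.reg 5 ∧ s.arr 8 (s.reg 10) < s.arr 8 x then 1 else 0 := by
    refine exec_loop rfl (fun y s' => ∀ x, s'.arr 10 x =
      s.arr 10 x + if x < y ∧ s.arr 8 (s.reg 10) < s.arr 8 x then 1 else 0) (by simp) ?_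
    intro y s' hlt hy hreg harr hQ x
    have h0 : s'.reg 10 = s.reg 10 := hreg 10 (by decide) rfl
    have h1 : s'.arr 8 = s.arr 8 := harr 8 rfl
    by_cases hxy : x = y
    · subst hxy
      simp [hy, hQ x, h0, h1, Expr.eval_lt]
    · have : x < y + 1 ↔ x < y := by omega
      simp [hy, hxy, hQ x, this]
  intro x hx
  rw [key x]; simp [hx]

/-- Fill the array `10` with the ranks of the endpoint columns; the array `9` marks the columns
that have been counted. -/
def rankProgram : LoopProgram :=
  .loop 10 5 (.ifLt (.read 9 (.read 8 (.reg 10))) (.const 1)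
    (.seq (.write 9 (.read 8 (.reg 10)) (.const 1)) countRight) .skip)

/-- A column occurring several times among the endpoints counts once, namely at its first
occurrence. -/
theorem rankAmong_succ (n : ℕ) (p : ℕ → OneBendPath) (m x : ℕ) :
    rankAmong n p (m + 1) x = rankAmong n p m x +
      if endpoint n p m ∉ (Finset.range m).image (endpoint n p) ∧ endpoint n p m < x
      then 1 else 0 := by
  unfold rankAmong
  rw [Finset.range_add_one, Finset.image_insert]
  by_cases h : endpoint n p m ∈ (Finset.range m).image (endpoint n p)
  · rw [Finset.insert_eq_of_mem h]; simp only [h]; simp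
  · rw [Finset.filter_insert]
    by_cases hx : endpoint n p m < x
    · rw [if_pos hx, Finset.card_insert_of_notMem fun h' => h (Finset.mem_filter.1 h').1,
        if_pos ⟨h, hx⟩]
    · rw [if_neg hx, if_neg fun h' => hx h'.2, add_zero]

/-- Array 9 is addressed by the column itself, however large, so a single read decides whether a
column has been counted already. -/
theorem rankProgram_arr {s : Store} {n : ℕ} {p : ℕ → OneBendPath} (h5 : s.reg 5 = n + n)
    (h8 : ∀ x < n + n, s.arr 8 x = endpoint n p x) (h9 : ∀ x, s.arr 9 x = 0)
    (h10 : ∀ x, s.arr 10 x = 0) : ∀ x < n + n,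
      (rankProgram.exec s).arr 10 x = columnRank n p (endpoint n p x) := by
  have key : (∀ v, (rankProgram.exec s).arr 9 v < 1 ↔
        v ∉ (Finset.range (s.reg 5)).image (endpoint n p)) ∧
      ∀ x < n + n, (rankProgram.exec s).arr 10 x =
        rankAmong n p (s.reg 5) (endpoint n p x) := by
    refine exec_loop rfl (fun m s' => (∀ v, s'.arr 9 v < 1 ↔
        v ∉ (Finset.range m).image (endpoint n p)) ∧
      ∀ x < n + n, s'.arr 10 x = rankAmong n p m (endpoint n p x)) ?_ ?_
    · simp [h9, h10, rankAmong]
    · intro m s' hm hr hreg harr hQ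
      have e8 : s'.arr 8 = s.arr 8 := harr 8 rfl
      have e5 : s'.reg 5 = s.reg 5 := hreg 5 (by decide) rfl
      have em : s'.arr 8 m = endpoint n p m := by rw [e8, h8 m (by omega)]
      have hcond := hQ.1 (endpoint n p m)
      simp only [exec_ifLt, Expr.eval_read, Expr.eval_reg, Expr.eval_const, hr, em]
      split_ifs with hc
      · have hmem := hcond.1 hc
        have hc9 : ∀ s'', (countRight.exec s'').arr 9 = s''.arr 9 := fun s'' =>
          exec_arr _ _ rfl
        refine ⟨fun v => ?_, fun x hx => ?_⟩
        · rw [Finset.range_add_one, Finset.image_insert]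
          simp only [exec_seq, Store.setReg_arr, hc9, exec_write, Store.setArr_arr,
            Expr.eval_read, Expr.eval_reg, hr, em, true_and, Expr.eval_const, Finset.mem_insert]
          by_cases hv : v = endpoint n p m
          · simp [hv]
          · simp only [hv, if_false, hQ.1 v, false_or]
        · rw [rankAmong_succ, exec_seq, Store.setReg_arr, countRight_arr _ _ (by simp; omega)]
          simp only [exec_write, Store.setArr_arr, Expr.eval_read, Expr.eval_reg, hr,
            Store.setArr_reg, hQ.2 x hx, e8, h8 x hx, h8 m (by omega)]
          simp only [hmem, not_false_eq_true, true_and]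
          simp
      · have hmem : endpoint n p m ∈ (Finset.range m).image (endpoint n p) := by
          by_contra h; exact hc (hcond.2 h)
        refine ⟨fun v => ?_, fun x hx => ?_⟩
        · rw [Finset.range_add_one, Finset.image_insert, Finset.insert_eq_of_mem hmem]
          simpa using hQ.1 v
        · rw [rankAmong_succ, if_neg fun h => h.1 hmem]
          simpa using hQ.2 x hx
  intro x hx
  rw [key.2 x hx, h5, columnRank]

section

/-! ### One shift -/

/-- The registers and tables on which the treatment of the shift `j` relies. -/
structure Layout (n k j : ℕ) (p : ℕ → OneBendPath) (s : Store) : Prop where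
  reg0 : s.reg 0 = n
  reg2 : s.reg 2 = k + k
  reg4 : s.reg 4 = (n + 1) ^ (k + k)
  path : ∀ i, s.path i = p i
  mod : ∀ x < (n + 1) ^ (k + k), s.arr 5 x = x % (n + 1)
  div : ∀ x < (n + 1) ^ (k + k), s.arr 6 x = x / (n + 1)
  mul : ∀ x < (n + 1) ^ (k + k), s.arr 7 x = x * (n + 1)
  cornerMod : ∀ i < n, s.arr 11 (s.arr 10 i) = cornerCol n j p i % k
  cornerDiv : ∀ i < n, s.arr 12 (s.arr 10 i) = cornerCol n j p i / k
  endMod : ∀ i < n, s.arr 11 (s.arr 10 (i + n)) = endCol n j p i % k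
  endDiv : ∀ i < n, s.arr 12 (s.arr 10 (i + n)) = endCol n j p i / k
  reg1 : s.reg 1 = k

variable {n k j : ℕ} {p : ℕ → OneBendPath} {s : Store}

/-- The working arrays 4, 13, 14 and 15 and the registers from 10 on are free, so the subprograms
for a shift preserve the layout. -/
theorem Layout.congr (h : Layout n k j p s) {s' : Store} (hr : ∀ x < 10, s'.reg x = s.reg x)
    (ha : ∀ x ∈ [0, 1, 2, 3, 5, 6, 7, 10, 11, 12], s'.arr x = s.arr x) : Layout n k j p s' := by
  simp only [List.forall_mem_cons] at ha
  obtain ⟨a0, a1, a2, a3, a5, a6, a7, a10, a11, a12, -⟩ := ha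
  constructor
  · rw [hr 0 (by decide), h.reg0]
  · rw [hr 2 (by decide), h.reg2]
  · rw [hr 4 (by decide), h.reg4]
  · intro i; rw [← h.path i]; simp only [Store.path, a0, a1, a2, a3]
  · rw [a5]; exact h.mod
  · rw [a6]; exact h.div
  · rw [a7]; exact h.mul
  · rw [a10, a11]; exact h.cornerMod
  · rw [a10, a12]; exact h.cornerDiv
  · rw [a10, a11]; exact h.endMod
  · rw [a10, a12]; exact h.endDiv
  · rw [hr 1 (by decide), h.reg1]

theorem Layout.exec (h : Layout n k j p s) {q : LoopProgram} (hq : q.wf)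
    (ha : ∀ x ∈ [0, 1, 2, 3, 5, 6, 7, 10, 11, 12], q.writesArr x = false) :
    Layout n k j p (q.exec s) :=
  h.congr (fun _ hx => exec_reg _ _ (writesReg_of_wf hq hx)) fun x hx => exec_arr _ _ (ha x hx)

theorem Layout.setReg (h : Layout n k j p s) {r v : ℕ} (hr : 10 ≤ r) :
    Layout n k j p (s.setReg r v) :=
  h.congr (fun x hx => by simp; omega) fun x hx => rfl

theorem Layout.cx (h : Layout n k j p s) (i : ℕ) : s.arr 0 i = (p i).cx := by rw [← h.path]; rfl
theorem Layout.cy (h : Layout n k j p s) (i : ℕ) : s.arr 1 i = (p i).cy := by rw [← h.path]; rfl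
theorem Layout.hx (h : Layout n k j p s) (i : ℕ) : s.arr 2 i = (p i).hx := by rw [← h.path]; rfl
theorem Layout.vy (h : Layout n k j p s) (i : ℕ) : s.arr 3 i = (p i).vy := by rw [← h.path]; rfl

/-! ### The relations of a shift as constant-time expressions -/

namespace Expr

/-- The offset of the corner in its slab. -/
def cornerOff (x : Expr) : Expr := .read 11 (.read 10 x)
/-- The slab of the corner. -/
def cornerSlab (x : Expr) : Expr := .read 12 (.read 10 x)
/-- The offset in its slab of the end of the horizontal part. -/
def endOff (x : Expr) : Expr := .read 11 (.read 10 (.add x (.reg 0)))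
/-- The slab of the end of the horizontal part. -/
def endSlab (x : Expr) : Expr := .read 12 (.read 10 (.add x (.reg 0)))
/-- The expression for `height`. -/
def height (x : Expr) : Expr := .add (.add (.read 1 x) (.read 1 x)) (lt (.read 1 x) (.read 3 x))
/-- The expression for `Before`. -/
def before (x y : Expr) : Expr :=
  or (lt x.cornerSlab y.cornerSlab) (and (eq x.cornerSlab y.cornerSlab)
    (or (lt x.height y.height) (and (eq x.height y.height) (lt x y))))
/-- The expression for the relation `use` of the shift system. -/
def use (x y : Expr) : Expr :=
  or (and (eq x.cornerOff y) (not (eq (.read 1 x) (.read 3 x))))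
    (and (not (lt y (.add (.reg 1) (min x.cornerOff x.endOff))))
      (lt y (.add (.reg 1) (max x.cornerOff x.endOff))))
/-- Two intervals, given by their ends in two arrays, overlap. -/
def overlap (a b : ℕ) (x y : Expr) : Expr :=
  lt (max (min (.read a x) (.read b x)) (min (.read a y) (.read b y)))
    (min (max (.read a x) (.read b x)) (max (.read a y) (.read b y)))
/-- The expression for `Meets`. -/
def meets (x y : Expr) : Expr :=
  or (and (eq (.read 1 x) (.read 1 y)) (overlap 0 2 x y))
    (and (eq (.read 0 x) (.read 0 y)) (overlap 1 3 x y))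

end Expr

theorem Layout.eval_height (h : Layout n k j p s) (x : Expr) :
    (Expr.height x).eval s = height p (x.eval s) := by
  simp only [Expr.height, Expr.eval_add, Expr.eval_read, Expr.eval_lt, h.cy, h.vy, EPG.height]

theorem Layout.eval_before (h : Layout n k j p s) {x y : Expr} (hx : x.eval s < n)
    (hy : y.eval s < n) : (Expr.before x y).eval s =
      if Before n k j p (x.eval s) (y.eval s) then 1 else 0 := by
  rw [Expr.before, Expr.eval_or]
  refine if_congr ?_ rfl rfl
  simp only [Expr.lt_pos, Expr.and_pos, Expr.eq_pos, Expr.or_pos, Expr.cornerSlab, Expr.eval_read,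
    h.eval_height, h.cornerDiv _ hx, h.cornerDiv _ hy, Before]

theorem Layout.use_pos (h : Layout n k j p s) {x y : Expr} (hx : x.eval s < n) :
    0 < (Expr.use x y).eval s ↔ (shiftSystem n k j p).use (x.eval s) (y.eval s) := by
  simp only [Expr.use, Expr.lt_pos, Expr.and_pos, Expr.eq_pos, Expr.or_pos, Expr.not_pos,
    Expr.cornerOff, Expr.endOff, Expr.eval_add, Expr.eval_read, Expr.eval_reg, h.cornerMod _ hx,
    h.endMod _ hx, h.cy, h.vy, h.reg0, h.reg1, Expr.eval_min, Expr.eval_max, not_lt, shiftSystem]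

theorem Layout.meets_pos (h : Layout n k j p s) {x y : Expr} :
    0 < (Expr.meets x y).eval s ↔ (p (x.eval s)).Meets (p (y.eval s)) := by
  simp only [Expr.meets, Expr.overlap, Expr.lt_pos, Expr.and_pos, Expr.eq_pos, Expr.or_pos,
    Expr.eval_read, h.cx, h.cy, h.hx, h.vy, Expr.eval_min, Expr.eval_max, OneBendPath.Meets]

theorem Layout.alive_pos (h : Layout n k j p s) {x : Expr} (hx : x.eval s < n) :
    0 < (Expr.eq x.cornerSlab x.endSlab).eval s ↔ (shiftSystem n k j p).alive (x.eval s) := by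
  simp only [Expr.eq_pos, Expr.cornerSlab, Expr.endSlab, Expr.eval_read, Expr.eval_add,
    Expr.eval_reg, h.reg0, h.cornerDiv _ hx, h.endDiv _ hx, shiftSystem]

/-- Count the predecessors of the path in the register `10`. -/
def countBefore : LoopProgram :=
  .loop 11 0 (.assign 20 (.add (.reg 20) (Expr.before (.reg 11) (.reg 10))))

theorem Layout.countBefore_reg (h : Layout n k j p s) (h10 : s.reg 10 < n) (h20 : s.reg 20 = 0) :
    (countBefore.exec s).reg 20 = position n k j p (s.reg 10) := by
  refine exec_loop h.reg0 (fun m s' => s'.reg 20 =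
    ((Finset.range m).filter (Before n k j p · (s.reg 10))).card) (by simp [h20]) ?_
  intro m s' hm hr hreg harr hQ
  have hl : Layout n k j p s' := by
    refine h.congr (fun x hx => hreg x (by omega) ?_) fun x _ => harr x rfl
    simp only [writesReg, beq_eq_false_iff_ne]; omega
  have e10 : s'.reg 10 = s.reg 10 := hreg 10 (by decide) rfl
  have := hl.eval_before (x := .reg 11) (y := .reg 10) (by simpa [hr]) (by simpa [e10])
  rw [Expr.eval_reg, Expr.eval_reg, hr, e10] at this
  simp only [exec_assign, Store.setReg_reg, Expr.eval_add, this, Expr.eval_reg, hQ,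
    Nat.reduceEqDiff, if_false, if_true]
  rw [Finset.range_add_one, Finset.filter_insert]
  split_ifs with hc
  · rw [Finset.card_insert_of_notMem (by simp)]
  · rfl

/-- Fill the array `13` with the paths in their linear order. -/
def orderProgram : LoopProgram :=
  .loop 10 0 (.seq (.assign 20 (.const 0)) (.seq countBefore (.write 13 (.reg 20) (.reg 10))))

/-- The position of a path is its number of predecessors. Writing the path there inverts `position`,
and injectivity rules out later overwriting. -/
theorem Layout.orderProgram_arr (h : Layout n k j p s) :
    ∀ q < n, (orderProgram.exec s).arr 13 q = (shiftSystem n k j p).ord q := by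
  have key : ∀ i < n, (orderProgram.exec s).arr 13 (position n k j p i) = i := by
    refine exec_loop h.reg0 (fun m s' => ∀ i < m, s'.arr 13 (position n k j p i) = i)
      (by simp) ?_
    intro m s' hm hr hreg harr hQ i hi
    have hl : Layout n k j p s' := by
      refine h.congr (fun x hx => hreg x (by omega) (writesReg_of_wf rfl hx)) fun x hx => harr x ?_
      simp only [List.mem_cons, List.not_mem_nil, or_false] at hx
      rcases hx with rfl | rfl | rfl | rfl | rfl | rfl | rfl | rfl | rfl | rfl <;> rfl
    have hc := (hl.setReg (r := 20) (v := 0) (by decide)).countBefore_reg (by simpa [hr]) (by simp)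
    have hc10 : ∀ s'', (countBefore.exec s'').reg 10 = s''.reg 10 := fun s'' => exec_reg _ _ rfl
    have hc13 : ∀ s'', (countBefore.exec s'').arr 13 = s''.arr 13 := fun s'' => exec_arr _ _ rfl
    simp only [exec_seq, exec_assign, exec_write, Store.setReg_arr, Store.setArr_arr,
      Expr.eval_const, Expr.eval_reg, hc, hc10, hc13, Store.setReg_reg, hr]
    rcases Nat.lt_or_ge i m with him | him
    · have : position n k j p i ≠ position n k j p m := fun h' => by
        have := position_injOn (show i ∈ Set.Iio n by simp; omega) (show m ∈ Set.Iio n from hm) h'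
        omega
      simpa [this] using hQ i him
    · obtain rfl : i = m := by omega
      simp
  intro q hq
  obtain ⟨i, hi, rfl⟩ := position_surj (k := k) (j := j) (p := p) hq
  rw [key i hi, ord_position hi]

/-- Decode the state in the register `26`, and clear the register `27` if the state does not fit
the path in the register `22`. -/
def decodeProgram : LoopProgram :=
  .loop 13 2 (.seq (.write 14 (.reg 13) (.read 5 (.reg 26)))
    (.seq (.assign 26 (.read 6 (.reg 26)))
      (.assign 27 (Expr.and (.reg 27) (Expr.not (Expr.and (.read 14 (.reg 13))
        (Expr.and (Expr.use (.reg 22) (.reg 13))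
          (Expr.meets (.sub (.read 14 (.reg 13)) (.const 1)) (.reg 22)))))))))

/-- Table lookups peel off the digits, lowest first: register 26 runs through the successive
quotients, and register 27 accumulates the tests of `Fits`. -/
theorem Layout.decodeProgram_spec (h : Layout n k j p s) (hi : s.reg 22 < n)
    (hσ : s.reg 26 < (n + 1) ^ (k + k))
    (h27 : 0 < s.reg 27 ↔ (shiftSystem n k j p).alive (s.reg 22)) :
    (0 < (decodeProgram.exec s).reg 27 ↔ (shiftSystem n k j p).Fits (s.reg 26) (s.reg 22)) ∧
      ∀ t < k + k, (decodeProgram.exec s).arr 14 t = digit (n + 1) (s.reg 26) t := by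
  have key : (decodeProgram.exec s).reg 26 = s.reg 26 / (n + 1) ^ (k + k) ∧
      (0 < (decodeProgram.exec s).reg 27 ↔ (shiftSystem n k j p).alive (s.reg 22) ∧
        ∀ t < k + k, ¬ (0 < digit (n + 1) (s.reg 26) t ∧
          (shiftSystem n k j p).use (s.reg 22) t ∧
          (p (digit (n + 1) (s.reg 26) t - 1)).Meets (p (s.reg 22)))) ∧
      ∀ t < k + k, (decodeProgram.exec s).arr 14 t = digit (n + 1) (s.reg 26) t := by
    refine exec_loop h.reg2 (fun m s' => s'.reg 26 = s.reg 26 / (n + 1) ^ m ∧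
      (0 < s'.reg 27 ↔ (shiftSystem n k j p).alive (s.reg 22) ∧
        ∀ t < m, ¬ (0 < digit (n + 1) (s.reg 26) t ∧
          (shiftSystem n k j p).use (s.reg 22) t ∧
          (p (digit (n + 1) (s.reg 26) t - 1)).Meets (p (s.reg 22)))) ∧
      ∀ t < m, s'.arr 14 t = digit (n + 1) (s.reg 26) t) (by simpa using h27) ?_
    intro m s' hm hr hreg harr ⟨hQ1, hQ2, hQ3⟩
    have hl : Layout n k j p s' := by
      refine h.congr (fun x hx => hreg x (by omega) (writesReg_of_wf rfl hx)) fun x hx => harr x ?_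
      simp only [List.mem_cons, List.not_mem_nil, or_false] at hx
      rcases hx with rfl | rfl | rfl | rfl | rfl | rfl | rfl | rfl | rfl | rfl <;> rfl
    have e22 : s'.reg 22 = s.reg 22 := hreg 22 (by decide) rfl
    -- Quotients never exceed the state, so they stay within the range of the tables.
    have hlt : s.reg 26 / (n + 1) ^ m < (n + 1) ^ (k + k) := (Nat.div_le_self _ _).trans_lt hσ
    have e5 : s'.arr 5 (s'.reg 26) = digit (n + 1) (s.reg 26) m := by
      rw [hQ1, hl.mod _ hlt, digit]
    have e6 : s'.arr 6 (s'.reg 26) = s.reg 26 / (n + 1) ^ (m + 1) := by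
      rw [hQ1, hl.div _ hlt, Nat.div_div_eq_div_mul, pow_succ]
    have hl' : Layout n k j p ((s'.setArr 14 m (digit (n + 1) (s.reg 26) m)).setReg 26
        (s.reg 26 / (n + 1) ^ (m + 1))) := by
      refine hl.congr (fun x hx => by simp; omega) fun x hx => ?_
      rw [Store.setReg_arr, Store.setArr_arr_of_ne]
      rintro rfl; simp at hx
    have hu := hl'.use_pos (x := .reg 22) (y := .reg 13) (by simpa [e22])
    simp only [exec_seq, exec_assign, exec_write, Expr.eval_read, Expr.eval_reg, hr, e5,
      Store.setArr_arr, e6, Store.setArr_reg, Nat.reduceEqDiff, false_and, if_false]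
    refine ⟨by simp, ?_, ?_⟩
    · simp only [Store.setReg_reg, Nat.reduceEqDiff, if_false, if_true, Expr.and_pos, Expr.not_pos,
        hu, hl'.meets_pos, Expr.eval_reg, Expr.eval_sub, Expr.eval_read, Expr.eval_const,
        Store.setArr_reg, Store.setReg_arr, Store.setArr_arr, true_and, hr, e22, hQ2, and_assoc]
      refine and_congr_right fun _ => ⟨fun ⟨h1, h2⟩ t ht => ?_, fun h1 => ⟨fun t ht => h1 t ?_, h1 m ?_⟩⟩
      · rcases Nat.lt_or_ge t m with htm | htm
        · exact h1 t htm
        · obtain rfl : t = m := by omega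
          exact h2
      · omega
      · omega
    · intro t ht
      simp only [Store.setReg_arr, Store.setArr_arr, true_and]
      split_ifs with hc
      · rw [hc]
      · exact hQ3 t (by omega)
  exact ⟨key.2.1, key.2.2⟩

/-- Compute in the register `28` the state after taking the path in the register `22`. -/
def encodeProgram : LoopProgram :=
  .loop 13 2 (.seq (.assign 24 (.sub (.sub (.reg 2) (.const 1)) (.reg 13)))
    (.ifLt (.const 0) (Expr.use (.reg 22) (.reg 24))
      (.assign 28 (.add (.read 7 (.reg 28)) (.add (.reg 22) (.const 1))))
      (.assign 28 (.add (.read 7 (.reg 28)) (.read 14 (.reg 24))))))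

/-- The slots are visited from k + k - 1 downwards, as `horner` requires; multiplication by n + 1 is
a lookup in array 7. -/
theorem Layout.encodeProgram_spec (h : Layout n k j p s) (hi : s.reg 22 < n) {σ : ℕ}
    (h14 : ∀ t < k + k, s.arr 14 t = digit (n + 1) σ t) (h28 : s.reg 28 = 0) :
    (encodeProgram.exec s).reg 28 = (shiftSystem n k j p).next σ (s.reg 22) := by
  refine exec_loop h.reg2 (fun m s' => s'.reg 28 =
    horner (n + 1) ((shiftSystem n k j p).nextDigit σ (s.reg 22)) (k + k) m)
    (by simpa [horner] using h28) ?_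
  intro m s' hm hr hreg harr hQ
  have hl : Layout n k j p s' := by
    refine h.congr (fun x hx => hreg x (by omega) (writesReg_of_wf rfl hx)) fun x hx => harr x ?_
    simp only [List.mem_cons, List.not_mem_nil, or_false] at hx
    rcases hx with rfl | rfl | rfl | rfl | rfl | rfl | rfl | rfl | rfl | rfl <;> rfl
  have e22 : s'.reg 22 = s.reg 22 := hreg 22 (by decide) rfl
  have e14 : s'.arr 14 = s.arr 14 := harr 14 rfl
  -- A partial Horner sum has m < k + k digits, hence is in the range of the multiplication table.
  have hlt : horner (n + 1) ((shiftSystem n k j p).nextDigit σ (s.reg 22)) (k + k) m <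
      (n + 1) ^ (k + k) :=
    (horner_lt (fun t _ => SlotSystem.nextDigit_lt (I := shiftSystem n k j p) hi t) hm.le).trans_le
      (Nat.pow_le_pow_right (by omega) hm.le)
  have e7 : s'.arr 7 (s'.reg 28) = horner (n + 1)
      ((shiftSystem n k j p).nextDigit σ (s.reg 22)) (k + k) m * (n + 1) := by
    rw [hQ, hl.mul _ hlt]
  have hu := (hl.setReg (r := 24) (v := k + k - 1 - m) (by decide)).use_pos
    (x := .reg 22) (y := .reg 24) (by simpa [e22])
  simp only [Expr.eval_reg, Store.setReg_reg, if_true, Nat.reduceEqDiff, if_false, e22] at hu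
  simp only [exec_seq, exec_assign, exec_ifPos, Expr.eval_sub, Expr.eval_reg, Expr.eval_const, hr,
    hl.reg2]
  rw [horner, SlotSystem.nextDigit]
  have h14' := h14 (k + k - 1 - m) (by omega)
  by_cases hc : (shiftSystem n k j p).use (s.reg 22) (k + k - 1 - m)
  · rw [if_pos hc, if_pos (hu.2 hc)]
    simp [e7, e22]
  · rw [if_neg hc, if_neg (mt hu.1 hc)]
    simp only [Expr.eval_add, Expr.eval_read, Expr.eval_reg, Store.setReg_arr, e14, h14', Store.setReg_reg, Nat.reduceEqDiff, if_false, if_true,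
      e7]
    rfl

/-- Decide whether to take the path in the register `22` in the state in the register `23`, the
values of the states being stored from the address in the register `21` on. -/
def stepProgram : LoopProgram :=
  .seq (.assign 26 (.reg 23)) (.seq (.assign 27 (Expr.eq (Expr.cornerSlab (.reg 22))
    (Expr.endSlab (.reg 22)))) (.seq decodeProgram (.seq (.assign 28 (.const 0))
      (.seq encodeProgram (.assign 29 (Expr.and (.reg 27) (Expr.lt
        (.read 15 (.add (.reg 21) (.reg 23)))
        (.add (.read 15 (.add (.reg 21) (.reg 28))) (.const 1)))))))))

/-- Filling the table and reading off a solution both run this program, so they take the same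
decision in each state. -/
theorem Layout.stepProgram_spec (h : Layout n k j p s) (hi : s.reg 22 < n)
    (hσ : s.reg 23 < (n + 1) ^ (k + k)) :
    (stepProgram.exec s).reg 28 = (shiftSystem n k j p).next (s.reg 23) (s.reg 22) ∧
      (0 < (stepProgram.exec s).reg 29 ↔ (shiftSystem n k j p).Fits (s.reg 23) (s.reg 22) ∧
        s.arr 15 (s.reg 21 + s.reg 23) < s.arr 15 (s.reg 21 +
          (shiftSystem n k j p).next (s.reg 23) (s.reg 22)) + 1) := by
  have ha : ∀ x ∈ [0, 1, 2, 3, 5, 6, 7, 10, 11, 12], decodeProgram.writesArr x = false := by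
    intro x hx
    simp only [List.mem_cons, List.not_mem_nil, or_false] at hx
    rcases hx with rfl | rfl | rfl | rfl | rfl | rfl | rfl | rfl | rfl | rfl <;> rfl
  have hl1 := h.setReg (r := 26) (v := s.reg 23) (by decide)
  have hal := hl1.alive_pos (x := .reg 22) (by simpa)
  set v := (Expr.eq (Expr.cornerSlab (.reg 22)) (Expr.endSlab (.reg 22))).eval
    (s.setReg 26 (s.reg 23)) with hv
  have hl2 := hl1.setReg (r := 27) (v := v) (by decide)
  set s₂ := (s.setReg 26 (s.reg 23)).setReg 27 v with hs₂
  have q26 : s₂.reg 26 = s.reg 23 := by simp [hs₂]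
  have q22 : s₂.reg 22 = s.reg 22 := by simp [hs₂]
  have q21 : s₂.reg 21 = s.reg 21 := by simp [hs₂]
  have q23 : s₂.reg 23 = s.reg 23 := by simp [hs₂]
  have q15 : s₂.arr 15 = s.arr 15 := by simp [hs₂]
  have hdec := hl2.decodeProgram_spec (by simpa [hs₂]) (by simpa [hs₂]) (by simpa [hs₂] using hal)
  have d21 : (decodeProgram.exec s₂).reg 21 = s₂.reg 21 := exec_reg _ _ rfl
  have d22 : (decodeProgram.exec s₂).reg 22 = s₂.reg 22 := exec_reg _ _ rfl
  have d23 : (decodeProgram.exec s₂).reg 23 = s₂.reg 23 := exec_reg _ _ rfl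
  have d15 : (decodeProgram.exec s₂).arr 15 = s₂.arr 15 := exec_arr _ _ rfl
  have hl3 := (hl2.exec (q := decodeProgram) rfl ha).setReg (r := 28) (v := 0) (by decide)
  have henc := hl3.encodeProgram_spec (σ := s₂.reg 26) (by simpa [d22] using q22.symm ▸ hi)
    (by simpa using hdec.2) (by simp)
  set s₃ := (decodeProgram.exec s₂).setReg 28 0 with hs₃
  have e21 : (encodeProgram.exec s₃).reg 21 = s₃.reg 21 := exec_reg _ _ rfl
  have e23 : (encodeProgram.exec s₃).reg 23 = s₃.reg 23 := exec_reg _ _ rfl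
  have e27 : (encodeProgram.exec s₃).reg 27 = s₃.reg 27 := exec_reg _ _ rfl
  have e15 : (encodeProgram.exec s₃).arr 15 = s₃.arr 15 := exec_arr _ _ rfl
  have r22 : s₃.reg 22 = s.reg 22 := by simp [hs₃, d22, q22]
  have r23 : s₃.reg 23 = s.reg 23 := by simp [hs₃, d23, q23]
  have r21 : s₃.reg 21 = s.reg 21 := by simp [hs₃, d21, q21]
  have r27 : s₃.reg 27 = (decodeProgram.exec s₂).reg 27 := by simp [hs₃]
  have r15 : s₃.arr 15 = s.arr 15 := by simp [hs₃, d15, q15]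
  rw [q26, r22] at henc
  rw [q26, q22] at hdec
  have hex : stepProgram.exec s = (Store.setReg (encodeProgram.exec s₃) 29
      ((Expr.and (.reg 27) (Expr.lt (.read 15 (.add (.reg 21) (.reg 23)))
        (.add (.read 15 (.add (.reg 21) (.reg 28))) (.const 1)))).eval
          (encodeProgram.exec s₃))) := rfl
  rw [hex]
  refine ⟨by simp [henc], ?_⟩
  simp only [Store.setReg_reg, if_true, Expr.and_pos, Expr.lt_pos, Expr.eval_reg, Expr.eval_read,
    Expr.eval_add, Expr.eval_const, e27, r27, hdec.1, e15, r15, e21, r21, e23, r23, henc]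

end

/-! ### The table of values and reading off an optimal set -/

section

variable {n k j : ℕ} {p : ℕ → OneBendPath} {s : Store}

theorem forall_layout_arrays {q : LoopProgram} (h : q.writesArr 0 = false ∧ q.writesArr 1 = false ∧
    q.writesArr 2 = false ∧ q.writesArr 3 = false ∧ q.writesArr 5 = false ∧ q.writesArr 6 = false ∧
    q.writesArr 7 = false ∧ q.writesArr 10 = false ∧ q.writesArr 11 = false ∧
    q.writesArr 12 = false) :
    ∀ x ∈ [0, 1, 2, 3, 5, 6, 7, 10, 11, 12], q.writesArr x = false := by
  simpa using h

/-- Store the value of the state in the register `11` for one more vertex. -/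
def fillState : LoopProgram :=
  .seq (.assign 23 (.reg 11)) (.seq stepProgram (.ifLt (.const 0) (.reg 29)
    (.write 15 (.add (.add (.reg 21) (.reg 4)) (.reg 23))
      (.add (.read 15 (.add (.reg 21) (.reg 28))) (.const 1)))
    (.write 15 (.add (.add (.reg 21) (.reg 4)) (.reg 23))
      (.read 15 (.add (.reg 21) (.reg 23))))))

open Classical in
theorem Layout.fillState_arr (h : Layout n k j p s) (hi : s.reg 22 < n)
    (hσ : s.reg 11 < (n + 1) ^ (k + k)) (x : ℕ) :
    (fillState.exec s).arr 15 x = if x = s.reg 21 + (n + 1) ^ (k + k) + s.reg 11 then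
      (if (shiftSystem n k j p).Fits (s.reg 11) (s.reg 22) ∧
          s.arr 15 (s.reg 21 + s.reg 11) < s.arr 15 (s.reg 21 +
            (shiftSystem n k j p).next (s.reg 11) (s.reg 22)) + 1 then
        s.arr 15 (s.reg 21 + (shiftSystem n k j p).next (s.reg 11) (s.reg 22)) + 1
      else s.arr 15 (s.reg 21 + s.reg 11)) else s.arr 15 x := by
  have hst := (h.setReg (r := 23) (v := s.reg 11) (by decide)).stepProgram_spec
    (by simpa using hi) (by simpa using hσ)
  set s₁ := s.setReg 23 (s.reg 11) with hs₁
  have q4 : s₁.reg 4 = (n + 1) ^ (k + k) := by simp [hs₁, h.reg4]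
  have q21 : s₁.reg 21 = s.reg 21 := by simp [hs₁]
  have q22 : s₁.reg 22 = s.reg 22 := by simp [hs₁]
  have q23 : s₁.reg 23 = s.reg 11 := by simp [hs₁]
  have q15 : s₁.arr 15 = s.arr 15 := by simp [hs₁]
  have e4 : (stepProgram.exec s₁).reg 4 = s₁.reg 4 := exec_reg _ _ rfl
  have e21 : (stepProgram.exec s₁).reg 21 = s₁.reg 21 := exec_reg _ _ rfl
  have e23 : (stepProgram.exec s₁).reg 23 = s₁.reg 23 := exec_reg _ _ rfl
  have e15 : (stepProgram.exec s₁).arr 15 = s₁.arr 15 := exec_arr _ _ rfl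
  rw [q21, q22, q23, q15] at hst
  rw [q21] at e21
  rw [q23] at e23
  rw [q15] at e15
  rw [q4] at e4
  rw [fillState, exec_seq, exec_assign, Expr.eval_reg, exec_seq, exec_ifPos, Expr.eval_reg]
  rw [← hs₁]
  by_cases hc : 0 < (stepProgram.exec s₁).reg 29
  · rw [if_pos hc, if_pos (hst.2.1 hc)]
    simp only [exec_write, Store.setArr_arr, Expr.eval_add, Expr.eval_reg, Expr.eval_read,
      Expr.eval_const, e21, e4, e23, e15, hst.1, true_and]
  · rw [if_neg hc, if_neg (mt hst.2.2 hc)]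
    simp only [exec_write, Store.setArr_arr, Expr.eval_add, Expr.eval_reg, Expr.eval_read,
      e21, e4, e23, e15, true_and]

theorem fillState_writesArr : ∀ x ∈ [0, 1, 2, 3, 5, 6, 7, 10, 11, 12, 13],
    fillState.writesArr x = false := by
  intro x hx
  simp only [List.mem_cons, List.not_mem_nil, or_false] at hx
  rcases hx with rfl | rfl | rfl | rfl | rfl | rfl | rfl | rfl | rfl | rfl | rfl <;> rfl

/-- Store the values of all states for one more vertex. -/
def fillRow : LoopProgram := .loop 11 4 fillState

/-- With N = (n + 1)^(2k) states, row r occupies N addresses from rN on. While row r + 1 is written,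
only row r is read, so the values read stay intact. -/
theorem Layout.fillRow_arr (h : Layout n k j p s) {r : ℕ} (hr : r < n)
    (h22 : s.reg 22 = (shiftSystem n k j p).ord (n - 1 - r))
    (h21 : s.reg 21 = r * (n + 1) ^ (k + k)) (hk : 0 < k)
    (h15 : ∀ r' ≤ r, ∀ σ < (n + 1) ^ (k + k),
      s.arr 15 (r' * (n + 1) ^ (k + k) + σ) = (shiftSystem n k j p).value r' σ) :
    ∀ r' ≤ r + 1, ∀ σ < (n + 1) ^ (k + k),
      (fillRow.exec s).arr 15 (r' * (n + 1) ^ (k + k) + σ) =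
        (shiftSystem n k j p).value r' σ := by
  have hi : s.reg 22 < n := by
    rw [h22]; exact (shiftSystem_valid hk).ord_lt (n - 1 - r) (by simp [shiftSystem]; omega)
  have key : (∀ r' ≤ r, ∀ σ < (n + 1) ^ (k + k), (fillRow.exec s).arr 15
        (r' * (n + 1) ^ (k + k) + σ) = (shiftSystem n k j p).value r' σ) ∧
      ∀ σ < (n + 1) ^ (k + k), (fillRow.exec s).arr 15 ((r + 1) * (n + 1) ^ (k + k) + σ) =
        (shiftSystem n k j p).value (r + 1) σ := by
    refine exec_loop h.reg4 (fun m s' => (∀ r' ≤ r, ∀ σ < (n + 1) ^ (k + k), s'.arr 15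
        (r' * (n + 1) ^ (k + k) + σ) = (shiftSystem n k j p).value r' σ) ∧
      ∀ σ < m, s'.arr 15 ((r + 1) * (n + 1) ^ (k + k) + σ) =
        (shiftSystem n k j p).value (r + 1) σ) ⟨h15, by simp⟩ ?_
    intro m s' hm hreg11 hreg harr ⟨hQ1, hQ2⟩
    have hl : Layout n k j p s' :=
      h.congr (fun x hx => hreg x (by omega) (writesReg_of_wf rfl hx)) fun x hx => harr x
        (fillState_writesArr x (by simp only [List.mem_cons] at hx ⊢; tauto))
    have e22 : s'.reg 22 = s.reg 22 := hreg 22 (by decide) rfl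
    have e21 : s'.reg 21 = s.reg 21 := hreg 21 (by decide) rfl
    have hf := hl.fillState_arr (e22 ▸ hi) (hreg11 ▸ hm)
    rw [e22, e21, hreg11, h21, hQ1 r le_rfl m hm, hQ1 r le_rfl _ (SlotSystem.next_lt hi), h22]
      at hf
    have hv := SlotSystem.value_succ (shiftSystem n k j p) r m
    rw [show (shiftSystem n k j p).n = n from rfl] at hv
    rw [← hv, ← add_one_mul] at hf
    simp only [Store.setReg_arr]
    refine ⟨fun r' hr' σ hσ => ?_, fun σ hσ => ?_⟩
    · have := Nat.mul_le_mul_right ((n + 1) ^ (k + k)) hr'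
      rw [hf, if_neg (by rw [add_one_mul]; omega), hQ1 r' hr' σ hσ]
    · rw [hf]
      rcases Nat.lt_or_ge σ m with hlt | hge
      · rw [if_neg (by omega), hQ2 σ hlt]
      · obtain rfl : σ = m := by omega
        rw [if_pos rfl]
  intro r' hr' σ hσ
  rcases Nat.lt_or_ge r' (r + 1) with hlt | hge
  · exact key.1 r' (by omega) σ hσ
  · obtain rfl : r' = r + 1 := by omega
    exact key.2 σ hσ

/-- Store the values of all states for all numbers of vertices. -/
def fillProgram : LoopProgram :=
  .seq (.assign 21 (.const 0)) (.loop 10 0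
    (.seq (.assign 22 (.read 13 (.sub (.sub (.reg 0) (.const 1)) (.reg 10))))
      (.seq fillRow (.assign 21 (.add (.reg 21) (.reg 4))))))

/-- Round m treats the vertex in position n - 1 - m, since `value` counts vertices from the end of
the order. Row 0 is the given zero row. -/
theorem Layout.fillProgram_spec (h : Layout n k j p s) (hk : 0 < k)
    (h13 : ∀ q < n, s.arr 13 q = (shiftSystem n k j p).ord q)
    (h15 : ∀ σ < (n + 1) ^ (k + k), s.arr 15 σ = 0) :
    (fillProgram.exec s).reg 21 = n * (n + 1) ^ (k + k) ∧
    ∀ r ≤ n, ∀ σ < (n + 1) ^ (k + k), (fillProgram.exec s).arr 15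
      (r * (n + 1) ^ (k + k) + σ) = (shiftSystem n k j p).value r σ := by
  rw [fillProgram, exec_seq, exec_assign]
  have h' := h.setReg (r := 21) (v := (Expr.const 0).eval s) (by decide)
  refine exec_loop h'.reg0 (fun m s' => s'.reg 21 = m * (n + 1) ^ (k + k) ∧
    ∀ r ≤ m, ∀ σ < (n + 1) ^ (k + k), s'.arr 15
      (r * (n + 1) ^ (k + k) + σ) = (shiftSystem n k j p).value r σ) ⟨by simp, ?_⟩ ?_
  · intro r hr σ hσ
    obtain rfl : r = 0 := by omega
    simp [h15 σ hσ, SlotSystem.value]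
  · intro m s' hm hreg10 hreg harr ⟨hQ1, hQ2⟩
    have hl : Layout n k j p s' :=
      h'.congr (fun x hx => hreg x (by omega) (writesReg_of_wf rfl hx)) fun x hx => harr x
        (forall_layout_arrays ⟨rfl, rfl, rfl, rfl, rfl, rfl, rfl, rfl, rfl, rfl⟩ x hx)
    have e13 : s'.arr 13 = s.arr 13 := harr 13 rfl
    rw [exec_seq, exec_assign, exec_seq]
    set v := (Expr.read 13 (.sub (.sub (.reg 0) (.const 1)) (.reg 10))).eval s' with hv
    have hv' : v = (shiftSystem n k j p).ord (n - 1 - m) := by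
      rw [hv, ← h13 _ (by omega)]
      simp [hreg10, hl.reg0, e13]
    have hl' := hl.setReg (r := 22) (v := v) (by decide)
    have hrow := hl'.fillRow_arr hm (by simp [hv']) (by simp [hQ1]) hk hQ2
    set s₁ := s'.setReg 22 v with hs₁
    have e21 : (fillRow.exec s₁).reg 21 = s₁.reg 21 := exec_reg _ _ rfl
    have e4 : (fillRow.exec s₁).reg 4 = s₁.reg 4 := exec_reg _ _ rfl
    refine ⟨?_, hrow⟩
    simp only [exec_assign, Store.setReg_reg, Nat.reduceEqDiff, if_false, if_true, Expr.eval_add,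
      Expr.eval_reg, e21, e4, hl'.reg4]
    simp [hs₁, hQ1, add_one_mul]

/-- Take or leave the vertex in the register `22`. -/
def extractVertex : LoopProgram :=
  .seq stepProgram (.ifLt (.const 0) (.reg 29)
    (.seq (.write 4 (.reg 22) (.const 1)) (.assign 23 (.reg 28)))
    (.write 4 (.reg 22) (.const 0)))

/-- Write an optimal set of vertices into the array `4`. -/
def extractProgram : LoopProgram :=
  .seq (.assign 23 (.const 0)) (.loop 10 0 (.seq (.assign 22 (.read 13 (.reg 10)))
    (.seq (.assign 21 (.sub (.reg 21) (.reg 4))) extractVertex)))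

/-- The order is traversed forwards while the row number decreases. The number of vertices taken
plus the value of the current state stays equal to the optimal value, and `Valid.indep_insert` keeps
the set independent. -/
theorem Layout.extractProgram_spec (h : Layout n k j p s) (hk : 0 < k)
    (h13 : ∀ q < n, s.arr 13 q = (shiftSystem n k j p).ord q)
    (h21 : s.reg 21 = n * (n + 1) ^ (k + k))
    (h15 : ∀ r ≤ n, ∀ σ < (n + 1) ^ (k + k), s.arr 15
      (r * (n + 1) ^ (k + k) + σ) = (shiftSystem n k j p).value r σ) :
    ∃ T, (shiftSystem n k j p).Indep T ∧
      (∀ i < n, (extractProgram.exec s).arr 4 i ≠ 0 ↔ i ∈ T) ∧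
      T.card = (shiftSystem n k j p).value n 0 := by
  have hI := shiftSystem_valid (n := n) (j := j) (p := p) hk
  set I := shiftSystem n k j p with hIdef
  have hIn : I.n = n := rfl
  rw [extractProgram, exec_seq, exec_assign]
  have h' := h.setReg (r := 23) (v := (Expr.const 0).eval s) (by decide)
  suffices hs : (∃ T, I.Indep T ∧ (∀ q ∈ T, I.pos q < n) ∧ (∀ i < n, I.pos i < n →
      (((loop 10 0 (.seq (.assign 22 (.read 13 (.reg 10)))
        (.seq (.assign 21 (.sub (.reg 21) (.reg 4))) extractVertex))).exec
          (s.setReg 23 ((Expr.const 0).eval s))).arr 4 i ≠ 0 ↔ i ∈ T)) ∧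
      T.card + I.value (n - n) (((loop 10 0 (.seq (.assign 22 (.read 13 (.reg 10)))
        (.seq (.assign 21 (.sub (.reg 21) (.reg 4))) extractVertex))).exec
          (s.setReg 23 ((Expr.const 0).eval s))).reg 23) = I.value n 0) by
    obtain ⟨T, h1, -, h3, h4⟩ := hs
    refine ⟨T, h1, fun i hi => h3 i hi (hI.pos_lt i hi), ?_⟩
    rw [← h4, Nat.sub_self]; rfl
  -- Array 4 may still hold the solution of an earlier shift, so the invariant describes it only at
  -- vertices already passed.
  have main := exec_loop (r := 10) (p := .seq (.assign 22 (.read 13 (.reg 10)))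
      (.seq (.assign 21 (.sub (.reg 21) (.reg 4))) extractVertex)) h'.reg0
    (fun m s' => s'.reg 21 = (n - m) * (n + 1) ^ (k + k) ∧ s'.reg 23 < (n + 1) ^ (k + k) ∧
      ∃ T, I.Indep T ∧ (∀ q ∈ T, I.pos q < m) ∧
        (∀ i < n, I.pos i < m → (s'.arr 4 i ≠ 0 ↔ i ∈ T)) ∧
        I.Represents (s'.reg 23) T ∧ T.card + I.value (n - m) (s'.reg 23) = I.value n 0) ?_ ?_
  · obtain ⟨-, -, T, h1, h2, h3, -, h5⟩ := main
    exact ⟨T, h1, h2, h3, h5⟩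
  · refine ⟨by simp [h21], by simp, ∅, by simp [SlotSystem.Indep], by simp, by simp,
      ?_, by simp⟩
    simpa using SlotSystem.represents_zero
  · intro m s' hm hreg10 hreg harr ⟨hQ1, hQ2, T, hT1, hT2, hT3, hT4, hT5⟩
    have hl : Layout n k j p s' :=
      h'.congr (fun x hx => hreg x (by omega) (writesReg_of_wf rfl hx)) fun x hx => harr x
        (forall_layout_arrays ⟨rfl, rfl, rfl, rfl, rfl, rfl, rfl, rfl, rfl, rfl⟩ x hx)
    have e13 : s'.arr 13 = s.arr 13 := harr 13 rfl
    have e15 : s'.arr 15 = s.arr 15 := harr 15 rfl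
    rw [exec_seq, exec_assign, exec_seq, exec_assign, Expr.eval_read, Expr.eval_reg, hreg10, e13,
      h13 m hm, Expr.eval_sub, Expr.eval_reg, Expr.eval_reg]
    have hin : I.ord m < n := hI.ord_lt m hm
    have hposi : I.pos (I.ord m) = m := hI.pos_ord m hm
    generalize hi : I.ord m = i at hin hposi ⊢
    have hv : (s'.setReg 22 i).reg 21 - (s'.setReg 22 i).reg 4 =
        (n - (m + 1)) * (n + 1) ^ (k + k) := by
      simp [hQ1, hl.reg4, ← Nat.sub_one_mul, Nat.sub_sub]
    rw [hv]
    have hl' := (hl.setReg (r := 22) (v := i) (by decide)).setReg (r := 21)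
      (v := (n - (m + 1)) * (n + 1) ^ (k + k)) (by decide)
    have hst := hl'.stepProgram_spec (by simpa using hin) (by simpa using hQ2)
    set s₁ := (s'.setReg 22 i).setReg 21 ((n - (m + 1)) * (n + 1) ^ (k + k)) with hs₁
    have q21 : s₁.reg 21 = (n - (m + 1)) * (n + 1) ^ (k + k) := by simp [hs₁]
    have q22 : s₁.reg 22 = i := by simp [hs₁]
    have q23 : s₁.reg 23 = s'.reg 23 := by simp [hs₁]
    have q15 : s₁.arr 15 = s.arr 15 := by simp [hs₁, e15]
    have q4 : s₁.arr 4 = s'.arr 4 := by simp [hs₁]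
    have e21 : (stepProgram.exec s₁).reg 21 = s₁.reg 21 := exec_reg _ _ rfl
    have e22 : (stepProgram.exec s₁).reg 22 = s₁.reg 22 := exec_reg _ _ rfl
    have e23 : (stepProgram.exec s₁).reg 23 = s₁.reg 23 := exec_reg _ _ rfl
    have e4 : (stepProgram.exec s₁).arr 4 = s₁.arr 4 := exec_arr _ _ rfl
    rw [q21] at e21
    rw [q22] at e22
    rw [q23] at e23
    rw [q4] at e4
    rw [q21, q22, q23, q15, h15 _ (by omega) _ hQ2, ← hIdef,
      h15 _ (by omega) _ (SlotSystem.next_lt (I := I) hin)] at hst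
    have hval := SlotSystem.value_succ I (n - (m + 1)) (s'.reg 23)
    rw [hIn, show n - 1 - (n - (m + 1)) = m by omega, show n - (m + 1) + 1 = n - m by omega, hi]
      at hval
    have hlt : ∀ q ∈ T, I.pos q < I.pos i := fun q hq => by rw [hposi]; exact hT2 q hq
    have hiT : i ∉ T := fun hmem => lt_irrefl _ (hlt i hmem)
    have hne : ∀ x < n, I.pos x < m + 1 → x ≠ i → I.pos x < m := by
      intro x hx hxm hxi
      have : I.pos x ≠ I.pos i := fun h' => hxi (by rw [← hI.ord_pos x hx, h', hI.ord_pos i hin])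
      omega
    rw [extractVertex, exec_seq, exec_ifPos, Expr.eval_reg]
    by_cases hc : 0 < (stepProgram.exec s₁).reg 29
    · have hc' := hst.2.1 hc
      rw [if_pos hc'] at hval
      rw [if_pos hc]
      simp only [exec_seq, exec_write, exec_assign, Expr.eval_reg, Expr.eval_const,
        Store.setArr_reg, Store.setReg_reg, Nat.reduceEqDiff, if_true, if_false, Store.setReg_arr,
        Store.setArr_arr, true_and, e21, e22, e4, hst.1]
      refine ⟨SlotSystem.next_lt (I := I) hin, insert i T,
        hI.indep_insert hT4 hT1 hin hlt hc'.1, ?_, ?_, hT4.insert hin hlt, ?_⟩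
      · intro q hq
        rcases Finset.mem_insert.1 hq with rfl | hq
        · omega
        · have := hT2 q hq; omega
      · intro x hx hxm
        by_cases hxi : x = i
        · simp [hxi]
        · simpa [hxi] using hT3 x hx (hne x hx hxm hxi)
      · rw [Finset.card_insert_of_notMem hiT]
        omega
    · have hc' := mt hst.2.2 hc
      rw [if_neg hc'] at hval
      rw [if_neg hc]
      simp only [exec_write, Expr.eval_reg, Expr.eval_const,
        Store.setArr_reg, Store.setReg_reg, Nat.reduceEqDiff, if_false, Store.setReg_arr,
        Store.setArr_arr, true_and, e21, e22, e4, e23]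
      refine ⟨hQ2, T, hT1, fun q hq => by have := hT2 q hq; omega, ?_, hT4, by omega⟩
      intro x hx hxm
      by_cases hxi : x = i
      · simpa [hxi] using hiT
      · simpa [hxi] using hT3 x hx (hne x hx hxm hxi)

end

section

variable {n k j : ℕ} {p : ℕ → OneBendPath} {s : Store}

/-! ### All shifts -/

/-- The registers and tables that serve all shifts. -/
structure Prepared (n k : ℕ) (p : ℕ → OneBendPath) (s : Store) : Prop where
  reg0 : s.reg 0 = n
  reg1 : s.reg 1 = k
  reg2 : s.reg 2 = k + k
  reg4 : s.reg 4 = (n + 1) ^ (k + k)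
  reg5 : s.reg 5 = n + n
  path : ∀ i, s.path i = p i
  mod : ∀ x < (n + 1) ^ (k + k), s.arr 5 x = x % (n + 1)
  div : ∀ x < (n + 1) ^ (k + k), s.arr 6 x = x / (n + 1)
  mul : ∀ x < (n + 1) ^ (k + k), s.arr 7 x = x * (n + 1)
  corner : ∀ i < n, s.arr 10 i = columnRank n p (p i).cx
  horEnd : ∀ i < n, s.arr 10 (i + n) = columnRank n p (p i).hx

theorem Prepared.congr (h : Prepared n k p s) {s' : Store} (hr : ∀ x < 10, s'.reg x = s.reg x)
    (ha : ∀ x ∈ [0, 1, 2, 3, 5, 6, 7, 10], s'.arr x = s.arr x) : Prepared n k p s' := by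
  simp only [List.forall_mem_cons] at ha
  obtain ⟨a0, a1, a2, a3, a5, a6, a7, a10, -⟩ := ha
  constructor
  · rw [hr 0 (by decide), h.reg0]
  · rw [hr 1 (by decide), h.reg1]
  · rw [hr 2 (by decide), h.reg2]
  · rw [hr 4 (by decide), h.reg4]
  · rw [hr 5 (by decide), h.reg5]
  · intro i; rw [← h.path i]; simp only [Store.path, a0, a1, a2, a3]
  · rw [a5]; exact h.mod
  · rw [a6]; exact h.div
  · rw [a7]; exact h.mul
  · rw [a10]; exact h.corner
  · rw [a10]; exact h.horEnd

/-- Ranks are at most n + n, the limit in register 5, so the table of divisions by k covers every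
endpoint column. -/
theorem Prepared.layout (h : Prepared n k p s) (hj : s.reg 12 < k) :
    Layout n k (s.reg 12) p ((divTable 11 12 5 1 (.reg 12)).exec s) := by
  have hr : ∀ x < 10, ((divTable 11 12 5 1 (.reg 12)).exec s).reg x = s.reg x :=
    fun x hx => exec_reg _ _ (writesReg_of_wf rfl hx)
  have hd := divTable_arr (m := 11) (d := 12) (l := 5) (b := 1) (e := .reg 12) (s := s)
    (by decide) (by decide) (by simpa [h.reg1] using hj)
  simp only [Expr.eval_reg, h.reg1, h.reg5] at hd
  have ha : ∀ x ∈ [0, 1, 2, 3, 5, 6, 7, 10],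
      (divTable 11 12 5 1 (.reg 12)).writesArr x = false := by
    intro x hx
    simp only [List.mem_cons, List.not_mem_nil, or_false] at hx
    rcases hx with rfl | rfl | rfl | rfl | rfl | rfl | rfl | rfl <;> rfl
  have h' := h.congr hr fun x hx => exec_arr _ _ (ha x hx)
  exact ⟨h'.reg0, h'.reg2, h'.reg4, h'.path, h'.mod, h'.div, h'.mul,
    fun i hi => by rw [h'.corner i hi]; exact (hd _ (columnRank_le _)).1,
    fun i hi => by rw [h'.corner i hi]; exact (hd _ (columnRank_le _)).2,
    fun i hi => by rw [h'.horEnd i hi]; exact (hd _ (columnRank_le _)).1,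
    fun i hi => by rw [h'.horEnd i hi]; exact (hd _ (columnRank_le _)).2, h'.reg1⟩

/-- Solve the instance of the shift in the register `12`, and keep its solution if it is better
than the best one so far, whose size is in the register `25`. -/
def shiftProgram : LoopProgram :=
  .seq (divTable 11 12 5 1 (.reg 12)) (.seq orderProgram (.seq fillProgram
    (.ifLt (.reg 25) (.read 15 (.reg 21))
      (.seq (.assign 25 (.read 15 (.reg 21))) extractProgram) .skip)))

/-- The array `4` holds an independent set, the register `25` its size. -/
def Solution (n : ℕ) (p : ℕ → OneBendPath) (s : Store) : Prop :=
  ∃ T : Finset ℕ, (∀ q ∈ T, q < n ∧ ∀ e ∈ T, q ≠ e → ¬ (p q).Meets (p e)) ∧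
    (∀ i < n, s.arr 4 i ≠ 0 ↔ i ∈ T) ∧ T.card = s.reg 25

/-- Row 0 of the table stays zero, which is all the next shift needs of array 15: the other rows are
rewritten before they are read. -/
theorem Prepared.shiftProgram_spec (h : Prepared n k p s) (hj : s.reg 12 < k)
    (h15 : ∀ σ < (n + 1) ^ (k + k), s.arr 15 σ = 0) (hsol : Solution n p s) :
    (∀ σ < (n + 1) ^ (k + k), (shiftProgram.exec s).arr 15 σ = 0) ∧
      Solution n p (shiftProgram.exec s) ∧ s.reg 25 ≤ (shiftProgram.exec s).reg 25 ∧
      (shiftSystem n k (s.reg 12) p).value n 0 ≤ (shiftProgram.exec s).reg 25 := by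
  have hk : 0 < k := by omega
  rw [shiftProgram, exec_seq, exec_seq, exec_seq]
  have hl := h.layout hj
  have a15 : ((divTable 11 12 5 1 (.reg 12)).exec s).arr 15 = s.arr 15 := exec_arr _ _ rfl
  have a4 : ((divTable 11 12 5 1 (.reg 12)).exec s).arr 4 = s.arr 4 := exec_arr _ _ rfl
  have a25 : ((divTable 11 12 5 1 (.reg 12)).exec s).reg 25 = s.reg 25 := exec_reg _ _ rfl
  generalize (divTable 11 12 5 1 (.reg 12)).exec s = s₁ at hl a15 a4 a25 ⊢
  have hord := hl.orderProgram_arr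
  have hl₂ := hl.exec (q := orderProgram) rfl
    (forall_layout_arrays ⟨rfl, rfl, rfl, rfl, rfl, rfl, rfl, rfl, rfl, rfl⟩)
  have b15 : (orderProgram.exec s₁).arr 15 = s₁.arr 15 := exec_arr _ _ rfl
  have b4 : (orderProgram.exec s₁).arr 4 = s₁.arr 4 := exec_arr _ _ rfl
  have b25 : (orderProgram.exec s₁).reg 25 = s₁.reg 25 := exec_reg _ _ rfl
  generalize orderProgram.exec s₁ = s₂ at hord hl₂ b15 b4 b25 ⊢
  have hfill := hl₂.fillProgram_spec hk hord (by rw [b15, a15]; exact h15)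
  have hl₃ := hl₂.exec (q := fillProgram) rfl
    (forall_layout_arrays ⟨rfl, rfl, rfl, rfl, rfl, rfl, rfl, rfl, rfl, rfl⟩)
  have c13 : (fillProgram.exec s₂).arr 13 = s₂.arr 13 := exec_arr _ _ rfl
  have c4 : (fillProgram.exec s₂).arr 4 = s₂.arr 4 := exec_arr _ _ rfl
  have c25 : (fillProgram.exec s₂).reg 25 = s₂.reg 25 := exec_reg _ _ rfl
  generalize fillProgram.exec s₂ = s₃ at hfill hl₃ c13 c4 c25 ⊢
  rw [← c13] at hord
  have hpos : 0 < (n + 1) ^ (k + k) := Nat.pow_pos (by omega)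
  have hbest : s₃.arr 15 (s₃.reg 21) = (shiftSystem n k (s.reg 12) p).value n 0 := by
    rw [hfill.1]; exact hfill.2 n le_rfl 0 hpos
  have hzero : ∀ σ < (n + 1) ^ (k + k), s₃.arr 15 σ = 0 := fun σ hσ => by
    simpa [SlotSystem.value] using hfill.2 0 (Nat.zero_le _) σ hσ
  have hsol₃ : Solution n p s₃ := by
    unfold Solution at *
    rwa [c4, b4, a4, c25, b25, a25]
  rw [c25.trans (b25.trans a25) |>.symm]
  simp only [exec_ifLt, Expr.eval_reg, Expr.eval_read, exec_skip, hbest]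
  split_ifs with hc
  · rw [exec_seq, exec_assign, Expr.eval_read, Expr.eval_reg, hbest]
    obtain ⟨T, hT1, hT2, hT3⟩ := (hl₃.setReg (r := 25)
      (v := (shiftSystem n k (s.reg 12) p).value n 0) (by decide)).extractProgram_spec hk
      (by simpa using hord) (by simpa using hfill.1) (by simpa using hfill.2)
    have d25 : ∀ s', (extractProgram.exec s').reg 25 = s'.reg 25 := fun s' => exec_reg _ _ rfl
    have d15 : ∀ s', (extractProgram.exec s').arr 15 = s'.arr 15 := fun s' => exec_arr _ _ rfl
    refine ⟨by simpa [d15] using hzero,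
      ⟨T, fun q hq => ⟨(hT1 q hq).1, (hT1 q hq).2.2⟩, hT2, by simp [hT3, d25]⟩, ?_, ?_⟩
    · simpa [d25] using hc.le
    · simp [d25]
  · exact ⟨hzero, hsol₃, le_rfl, not_lt.1 hc⟩

/-- The program, after the initialization of the limit registers. -/
def mainProgram : LoopProgram :=
  .seq (divTable 5 6 4 3 (.const 0)) (.seq mulTable (.seq endpointProgram (.seq rankProgram
    (.loop 12 1 shiftProgram))))

theorem prepared (hp : ∀ i, s.path i = p i) (h0 : s.reg 0 = n) (h1 : s.reg 1 = k)
    (h2 : s.reg 2 = k + k) (h3 : s.reg 3 = n + 1) (h4 : s.reg 4 = (n + 1) ^ (k + k))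
    (h5 : s.reg 5 = n + n) (h9 : ∀ x, s.arr 9 x = 0) (h10 : ∀ x, s.arr 10 x = 0) :
    Prepared n k p (rankProgram.exec (endpointProgram.exec (mulTable.exec
      ((divTable 5 6 4 3 (.const 0)).exec s)))) := by
  have hdiv := divTable_arr (m := 5) (d := 6) (l := 4) (b := 3) (e := .const 0) (s := s)
    (by decide) (by decide) (by simp [h3])
  simp only [h3, h4, Expr.eval_const, add_zero] at hdiv
  have hr1 : ∀ x < 10, ((divTable 5 6 4 3 (.const 0)).exec s).reg x = s.reg x :=
    fun x hx => exec_reg _ _ (writesReg_of_wf rfl hx)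
  have ha1 : ∀ x, x ≠ 5 → x ≠ 6 → ((divTable 5 6 4 3 (.const 0)).exec s).arr x = s.arr x :=
    fun x h5 h6 => exec_arr _ _ (by simp [divTable, writesArr, h5, h6])
  generalize (divTable 5 6 4 3 (.const 0)).exec s = s₁ at *
  have hmul := mulTable_arr s₁
  rw [hr1 4 (by decide), hr1 3 (by decide), h3, h4] at hmul
  have hr2 : ∀ x < 10, (mulTable.exec s₁).reg x = s₁.reg x :=
    fun x hx => exec_reg _ _ (writesReg_of_wf rfl hx)
  have ha2 : ∀ x, x ≠ 7 → (mulTable.exec s₁).arr x = s₁.arr x :=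
    fun x h7 => exec_arr _ _ (by simp [mulTable, writesArr, h7])
  generalize mulTable.exec s₁ = s₂ at *
  have hpath : s₂.path = p := by
    funext i
    rw [← hp i]
    simp [Store.path, ha1, ha2]
  have hend := endpointProgram_arr s₂
  rw [hpath, hr2 0 (by decide), hr1 0 (by decide), h0] at hend
  have hr3 : ∀ x < 10, (endpointProgram.exec s₂).reg x = s₂.reg x :=
    fun x hx => exec_reg _ _ (writesReg_of_wf rfl hx)
  have ha3 : ∀ x, x ≠ 8 → (endpointProgram.exec s₂).arr x = s₂.arr x :=
    fun x h8 => exec_arr _ _ (by simp [endpointProgram, writesArr, h8])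
  generalize endpointProgram.exec s₂ = s₃ at *
  have hrank := rankProgram_arr (s := s₃) (n := n) (p := p) (by simp [hr3, hr2, hr1, h5]) hend
    (by simp [ha3, ha2, ha1, h9]) (by simp [ha3, ha2, ha1, h10])
  have hr4 : ∀ x < 10, (rankProgram.exec s₃).reg x = s₃.reg x :=
    fun x hx => exec_reg _ _ (writesReg_of_wf rfl hx)
  have ha4 : ∀ x, x ≠ 9 → x ≠ 10 → (rankProgram.exec s₃).arr x = s₃.arr x :=
    fun x h9 h10 => exec_arr _ _ (by simp [rankProgram, countRight, writesArr, h9, h10])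
  generalize rankProgram.exec s₃ = s₄ at *
  have hr : ∀ x < 10, s₄.reg x = s.reg x := fun x hx => by
    rw [hr4 x hx, hr3 x hx, hr2 x hx, hr1 x hx]
  constructor
  · rw [hr 0 (by decide), h0]
  · rw [hr 1 (by decide), h1]
  · rw [hr 2 (by decide), h2]
  · rw [hr 4 (by decide), h4]
  · rw [hr 5 (by decide), h5]
  · intro i; rw [← hp i]; simp [Store.path, ha4, ha3, ha2, ha1]
  · intro x hx; simpa [ha4, ha3, ha2] using (hdiv x hx.le).1
  · intro x hx; simpa [ha4, ha3, ha2] using (hdiv x hx.le).2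
  · intro x hx; simpa [ha4, ha3] using hmul x hx.le
  · intro i hi; rw [hrank i (by omega)]; simp [endpoint, hi]
  · intro i hi; rw [hrank (i + n) (by omega)]; simp [endpoint]

/-- The main program finds an independent set that is at least as large as the optimal ones of all
shifts. -/
theorem mainProgram_spec (hp : ∀ i, s.path i = p i) (h0 : s.reg 0 = n) (h1 : s.reg 1 = k)
    (h2 : s.reg 2 = k + k) (h3 : s.reg 3 = n + 1) (h4 : s.reg 4 = (n + 1) ^ (k + k))
    (h5 : s.reg 5 = n + n) (h25 : s.reg 25 = 0) (h : ∀ a, 4 ≤ a → ∀ x, s.arr a x = 0) :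
    Solution n p (mainProgram.exec s) ∧
      ∀ j < k, (shiftSystem n k j p).value n 0 ≤ (mainProgram.exec s).reg 25 := by
  have hpr := prepared hp h0 h1 h2 h3 h4 h5 (h 9 (by decide)) (h 10 (by decide))
  have h15' : (rankProgram.exec (endpointProgram.exec (mulTable.exec
      ((divTable 5 6 4 3 (.const 0)).exec s)))).arr 15 = s.arr 15 := by
    rw [exec_arr _ _ rfl, exec_arr _ _ rfl, exec_arr _ _ rfl, exec_arr _ _ rfl]
  have h4' : (rankProgram.exec (endpointProgram.exec (mulTable.exec
      ((divTable 5 6 4 3 (.const 0)).exec s)))).arr 4 = s.arr 4 := by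
    rw [exec_arr _ _ rfl, exec_arr _ _ rfl, exec_arr _ _ rfl, exec_arr _ _ rfl]
  have h25' : (rankProgram.exec (endpointProgram.exec (mulTable.exec
      ((divTable 5 6 4 3 (.const 0)).exec s)))).reg 25 = s.reg 25 := by
    rw [exec_reg _ _ rfl, exec_reg _ _ rfl, exec_reg _ _ rfl, exec_reg _ _ rfl]
  rw [mainProgram, exec_seq, exec_seq, exec_seq, exec_seq]
  generalize rankProgram.exec (endpointProgram.exec (mulTable.exec
      ((divTable 5 6 4 3 (.const 0)).exec s))) = s₁ at *
  refine (exec_loop hpr.reg1 (fun m s' => (∀ σ < (n + 1) ^ (k + k), s'.arr 15 σ = 0) ∧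
    Solution n p s' ∧ ∀ j < m, (shiftSystem n k j p).value n 0 ≤ s'.reg 25) ?_ ?_).2
  · refine ⟨fun σ _ => by simp [h15', h], ⟨∅, by simp, fun i _ => ?_, ?_⟩, by simp⟩
    · simp [h4', h]
    · simp [h25', h25]
  · intro m s' hm hr hreg harr ⟨hQ1, hQ2, hQ3⟩
    have hp' : Prepared n k p s' := by
      refine hpr.congr (fun x hx => hreg x (by omega) (writesReg_of_wf rfl hx)) fun x hx =>
        harr x ?_
      simp only [List.mem_cons, List.not_mem_nil, or_false] at hx
      rcases hx with rfl | rfl | rfl | rfl | rfl | rfl | rfl | rfl <;> rfl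
    obtain ⟨k1, k2, k3, k4⟩ := hp'.shiftProgram_spec (hr ▸ hm) hQ1 hQ2
    rw [hr] at k4
    refine ⟨by simpa using k1, by simpa [Solution] using k2, fun j hj => ?_⟩
    simp only [Store.setReg_reg, Nat.reduceEqDiff, if_false]
    rcases Nat.lt_or_ge j m with hjm | hjm
    · exact (hQ3 j hjm).trans k3
    · obtain rfl : j = m := by omega
      exact k4

/-! ### Running time -/

/-- The largest product of the limits of nested loops. -/
def LoopProgram.nest (L : ℕ → ℕ) : LoopProgram → ℕ
  | .skip => 1
  | .assign _ _ => 1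
  | .write _ _ _ => 1
  | .seq p q => max (p.nest L) (q.nest L)
  | .ifLt _ _ p q => max (p.nest L) (q.nest L)
  | .loop _ l p => L l * p.nest L

/-- The first factor depends on the program text only. As all bounds are at least 1, the nesting
product absorbs the additive costs of tests and increments. -/
theorem LoopProgram.cost_le (L L' : ℕ → ℕ) (hL : ∀ l, L l ≤ L' l) (h1 : ∀ l, 1 ≤ L' l)
    (p : LoopProgram) : 1 ≤ p.nest L' ∧ p.cost L ≤ p.cost (fun _ => 1) * p.nest L' := by
  induction p with
  | skip | assign | write => simp [nest, LoopProgram.cost]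
  | seq p q ihp ihq =>
    have hp := ihp.2.trans (Nat.mul_le_mul_left _ (le_max_left _ (q.nest L')))
    have hq := ihq.2.trans (Nat.mul_le_mul_left _ (le_max_right (p.nest L') _))
    refine ⟨ihp.1.trans (le_max_left _ _), ?_⟩
    simp only [LoopProgram.cost, nest, add_mul]
    omega
  | ifLt e₁ e₂ p q ihp ihq =>
    have hp := ihp.2.trans (Nat.mul_le_mul_left _ (le_max_left _ (q.nest L')))
    have hq := ihq.2.trans (Nat.mul_le_mul_left _ (le_max_right (p.nest L') _))
    have h := ihp.1.trans (le_max_left _ (q.nest L'))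
    refine ⟨h, ?_⟩
    simp only [LoopProgram.cost, nest, add_mul _ _ (max _ _)]
    have := Nat.mul_le_mul_left (e₁.cost + e₂.cost) h
    simp only [add_mul] at this
    omega
  | loop r l p ih =>
    have h := Nat.mul_le_mul (h1 l) ih.1
    refine ⟨h, ?_⟩
    simp only [LoopProgram.cost, nest]
    calc L l * (p.cost L + 7) + 5
        ≤ L' l * (p.cost (fun _ => 1) * p.nest L' + 7 * p.nest L') + 5 * (L' l * p.nest L') := by
          gcongr
          · exact hL l
          · exact ih.2
          · exact Nat.le_mul_of_pos_right _ ih.1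
          · exact Nat.le_mul_of_pos_right _ h
      _ = (1 * (p.cost (fun _ => 1) + 7) + 5) * (L' l * p.nest L') := by ring

/-- Upper bounds for the contents of the limit registers. -/
def limitBounds (n k : ℕ) (r : ℕ) : ℕ :=
  if r = 1 ∨ r = 2 then k + k + 1 else if r = 4 then (n + 1) ^ (k + k) else n + n + 1

/-- The nest of shifts, vertices, states and slots contributes the factors K, X, N, K. The second
factor X pays for the quadratic ranking and ordering loops. -/
theorem nest_mainProgram : mainProgram.nest (limitBounds n k) ≤
    (k + k + 1) ^ 2 * (n + n + 1) ^ 2 * (n + 1) ^ (k + k) := by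
  simp only [mainProgram, nest, divTable, mulTable, endpointProgram, rankProgram, countRight,
    shiftProgram, orderProgram, countBefore, fillProgram, fillRow, fillState, stepProgram,
    decodeProgram, encodeProgram, extractProgram, extractVertex, limitBounds]
  have hK : 0 < k + k + 1 := by omega
  have hX : 0 < n + n + 1 := by omega
  have hN : 0 < (n + 1) ^ (k + k) := Nat.pow_pos (by omega)
  generalize (n + 1) ^ (k + k) = N at *
  norm_num
  generalize k + k + 1 = K at *
  generalize n + n + 1 = X at *
  have hpos : 0 < K ^ 2 * X ^ 2 * N := by positivity
  have hpos' : 0 < K * X ^ 2 * N := by positivity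
  have hinner : max (X * X) (max (X * max (N * K) 1) (max 1 (X * K))) ≤ K * X ^ 2 * N := by
    rw [← Nat.mul_max_mul_left]
    refine max_le ?_ (max_le (max_le ?_ ?_) (max_le hpos' ?_)) <;>
      refine Nat.le_of_dvd hpos' ?_
    · exact ⟨K * N, by ring⟩
    · exact ⟨X, by ring⟩
    · exact ⟨K * X * N, by ring⟩
    · exact ⟨X * N, by ring⟩
  refine ⟨Nat.le_of_dvd hpos ⟨K ^ 2 * X ^ 2, by ring⟩, Nat.le_of_dvd hpos ⟨K ^ 2 * N, by ring⟩,
    (Nat.mul_le_mul_left K hinner).trans (le_of_eq (by ring))⟩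

theorem nest_powerProgram : powerProgram.nest (limitBounds n k) ≤
    (k + k + 1) ^ 2 * (n + n + 1) ^ 2 * (n + 1) ^ (k + k) := by
  have hpos : 0 < (k + k + 1) ^ 2 * (n + n + 1) ^ 2 * (n + 1) ^ (k + k) := by positivity
  simp only [powerProgram, addProduct, nest, limitBounds]
  norm_num
  exact ⟨hpos, Nat.le_of_dvd hpos ⟨(k + k + 1) * (n + n + 1) * (n + 1) ^ (k + k), by ring⟩⟩

/-- The whole program for slabs of `k` columns. -/
def slabProgram (k : ℕ) : Program :=
  .seq (.assign 1 (.const k)) (.seq (.assign 2 (.const (k + k)))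
    (.seq (.assign 3 (.add (.reg 0) (.const 1))) (.seq (.assign 5 (.add (.reg 0) (.reg 0)))
      (.seq powerProgram.compile (.seq (.assign 4 (.reg 20)) mainProgram.compile)))))

/-- The number of states goes into the limit register 4, which no well-formed loop program assigns.
Hence two loop programs are run, with that assignment between them. -/
theorem run_slabProgram (h0 : ∀ r ≠ 0, s.reg r = 0) (h : ∀ a, 4 ≤ a → ∀ x, s.arr a x = 0) :
    ∃ t s', Run (slabProgram k) s t s' ∧ Solution (s.reg 0) s.path s' ∧
      (∀ j < k, (shiftSystem (s.reg 0) k j s.path).value (s.reg 0) 0 ≤ s'.reg 25) ∧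
      t ≤ 20 + (powerProgram.cost (fun _ => 1) + mainProgram.cost (fun _ => 1)) *
        ((k + k + 1) ^ 2 * (s.reg 0 + s.reg 0 + 1) ^ 2 * (s.reg 0 + 1) ^ (k + k)) := by
  set n := s.reg 0 with hn
  set s₁ := (((s.setReg 1 k).setReg 2 (k + k)).setReg 3 (n + 1)).setReg 5 (n + n) with hs₁
  have r0 : s₁.reg 0 = n := by simp [hs₁, hn]
  have r1 : s₁.reg 1 = k := by simp [hs₁]
  have r2 : s₁.reg 2 = k + k := by simp [hs₁]
  have r3 : s₁.reg 3 = n + 1 := by simp [hs₁]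
  have r5 : s₁.reg 5 = n + n := by simp [hs₁]
  have ra : s₁.arr = s.arr := by simp [hs₁]
  have rr : ∀ r, 5 < r → s₁.reg r = 0 := fun r hr => by
    simp only [hs₁, Store.setReg_reg]
    rw [if_neg (by omega), if_neg (by omega), if_neg (by omega), if_neg (by omega),
      h0 r (by omega)]
  have r4 : s₁.reg 4 = 0 := by simp [hs₁, h0]
  have hpow := powerProgram_reg s₁
  rw [r2, r3] at hpow
  have hone : ∀ l, 1 ≤ limitBounds n k l := by
    intro l
    unfold limitBounds
    have : 0 < (n + 1) ^ (k + k) := by positivity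
    split_ifs <;> omega
  -- `cost_le` wants a bound for every index; working registers are never limits and are replaced by
  -- 0.
  have hb₁ : ∀ l, (if l < 10 then s₁.reg l else 0) ≤ limitBounds n k l := by
    intro l
    have := hone l
    rcases lt_trichotomy l 5 with hl | rfl | hl
    · interval_cases l <;> simp [limitBounds, r0, r1, r2, r3, r4] <;> omega
    · simp [limitBounds, r5]
    · rw [rr l hl]; split_ifs <;> omega
  obtain ⟨t₁, ht₁, hrun₁⟩ := run_compile (fun l => if l < 10 then s₁.reg l else 0) powerProgram rfl
    s₁ fun l hl => by simp [hl]
  have hpr : ∀ x < 10, (powerProgram.exec s₁).reg x = s₁.reg x :=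
    fun x hx => exec_reg _ _ (writesReg_of_wf rfl hx)
  have hpr25 : (powerProgram.exec s₁).reg 25 = s₁.reg 25 := exec_reg _ _ rfl
  have hpa : (powerProgram.exec s₁).arr = s₁.arr := by funext x; exact exec_arr _ _ rfl
  generalize powerProgram.exec s₁ = s₂ at *
  set s₃ := s₂.setReg 4 ((n + 1) ^ (k + k)) with hs₃
  have q0 : s₃.reg 0 = n := by simp [hs₃, hpr, r0]
  have q1 : s₃.reg 1 = k := by simp [hs₃, hpr, r1]
  have q2 : s₃.reg 2 = k + k := by simp [hs₃, hpr, r2]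
  have q3 : s₃.reg 3 = n + 1 := by simp [hs₃, hpr, r3]
  have q4 : s₃.reg 4 = (n + 1) ^ (k + k) := by simp [hs₃]
  have q5 : s₃.reg 5 = n + n := by simp [hs₃, hpr, r5]
  have qa : s₃.arr = s.arr := by simp [hs₃, hpa, ra]
  have hb₃ : ∀ l, (if l < 10 then s₃.reg l else 0) ≤ limitBounds n k l := by
    intro l
    have := hone l
    rcases lt_trichotomy l 5 with hl | rfl | hl
    · interval_cases l <;> simp [limitBounds, q0, q1, q2, q3, q4] <;> omega
    · simp [limitBounds, q5]
    · split_ifs with hl'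
      · rw [hs₃, Store.setReg_reg, if_neg (by omega), hpr l hl', rr l hl]; omega
      · omega
  obtain ⟨t₃, ht₃, hrun₃⟩ := run_compile (fun l => if l < 10 then s₃.reg l else 0) mainProgram rfl
    s₃ fun l hl => by simp [hl]
  have hspec := mainProgram_spec (s := s₃) (p := s.path) (fun i => by simp [Store.path, qa])
    q0 q1 q2 q3 q4 q5 (by rw [hs₃, Store.setReg_reg, if_neg (by decide), hpr25, rr 25 (by decide)])
    (by rw [qa]; exact h)
  have hfour := Run.assign 4 (.reg 20) s₂
  rw [Expr.eval_reg, hpow, ← hs₃] at hfour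
  have i1 := Run.assign 1 (.const k) s
  have i2 := Run.assign 2 (.const (k + k)) (s.setReg 1 k)
  have i3 := Run.assign 3 (.add (.reg 0) (.const 1)) ((s.setReg 1 k).setReg 2 (k + k))
  have i5 := Run.assign 5 (.add (.reg 0) (.reg 0))
    (((s.setReg 1 k).setReg 2 (k + k)).setReg 3 (n + 1))
  have e3 : (Expr.add (.reg 0) (.const 1)).eval ((s.setReg 1 k).setReg 2 (k + k)) = n + 1 := by
    simp [hn]
  have e5 : (Expr.add (.reg 0) (.reg 0)).eval
      (((s.setReg 1 k).setReg 2 (k + k)).setReg 3 (n + 1)) = n + n := by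
    simp [hn]
  rw [e3] at i3
  rw [e5] at i5
  refine ⟨_, _, i1.seq (i2.seq (i3.seq (i5.seq (hrun₁.seq (hfour.seq hrun₃))))), hspec.1,
    hspec.2, ?_⟩
  have c₁ := (cost_le _ _ hb₁ hone powerProgram).2.trans
    (Nat.mul_le_mul_left _ nest_powerProgram)
  have c₃ := (cost_le _ _ hb₃ hone mainProgram).2.trans
    (Nat.mul_le_mul_left _ nest_mainProgram)
  rw [add_mul]
  -- The five explicit assignments take 14 steps, covered by the constant 20.
  simp only [Expr.cost]
  omega

end

/-! ### Back to the graph: approximation ratio and time bound -/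

section

variable {n k : ℕ}

theorem path_inputStore (P : Fin n → OneBendPath) {i : ℕ} (hi : i < n) :
    (inputStore P).path i = P ⟨i, hi⟩ := by
  simp [Store.path, inputStore, hi]

theorem adj_iff_meets (P : Fin n → OneBendPath) (i i' : Fin n) :
    (epgGraph P).Adj i i' ↔ i ≠ i' ∧ ((inputStore P).path i).Meets ((inputStore P).path i') := by
  rw [path_inputStore P i.2, path_inputStore P i'.2, ← OneBendPath.edges_inter_nonempty]
  rfl

/-- A solution is an independent set of the graph. -/
theorem Solution.outputSet {P : Fin n → OneBendPath} {s : Store}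
    (h : Solution n (inputStore P).path s) :
    (epgGraph P).IsIndepSet (outputSet n s : Set (Fin n)) ∧ (outputSet n s).card = s.reg 25 := by
  obtain ⟨T, hT1, hT2, hT3⟩ := h
  have hmem : ∀ i : Fin n, i ∈ EPG.outputSet n s ↔ (i : ℕ) ∈ T := fun i => by
    simp [EPG.outputSet, ← hT2 i i.2]
  refine ⟨fun i hi i' hi' hne hadj => ?_, ?_⟩
  · rw [Finset.mem_coe, hmem] at hi hi'
    exact (hT1 i hi).2 i' hi' (fun h => hne (Fin.ext h)) ((adj_iff_meets P i i').1 hadj).2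
  · rw [← hT3, ← Finset.card_map Fin.valEmbedding]
    congr 1
    ext x
    simp only [Finset.mem_map, Fin.valEmbedding_apply, hmem]
    exact ⟨fun ⟨i, hi, hix⟩ => hix ▸ hi, fun hx => ⟨⟨x, (hT1 x hx).1⟩, hx, rfl⟩⟩

/-- Some shift loses at most the share `c / k` of an optimal solution. -/
theorem exists_value_ge (hk : 0 < k) {c : ℕ} (P : Fin n → OneBendPath)
    (hc : ∀ i, (P i).horLength ≤ c) : ∃ j < k, k * (epgGraph P).indepNum ≤
      k * (shiftSystem n k j (inputStore P).path).value n 0 + c * (epgGraph P).indepNum := by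
  obtain ⟨S, hS⟩ := (epgGraph P).exists_isNIndepSet_indepNum
  have hcard : (S.map Fin.valEmbedding).card = (epgGraph P).indepNum := by
    rw [Finset.card_map, hS.card_eq]
  have hlt : ∀ x ∈ S.map Fin.valEmbedding, x < n := by
    intro x hx
    obtain ⟨i, _, rfl⟩ := Finset.mem_map.1 hx
    exact i.2
  obtain ⟨j, hj, hcut⟩ := exists_shift (n := n) (p := (inputStore P).path) hk (c := c)
    (S := S.map Fin.valEmbedding) fun x hx => by
      rw [path_inputStore P (hlt x hx)]; exact hc _
  refine ⟨j, hj, ?_⟩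
  -- The uncut part of an optimal set is independent in the shift system, hence no larger than its
  -- value.
  have hle := (shiftSystem_valid (n := n) (j := j) (p := (inputStore P).path) hk).card_le_value_zero
    (S := (S.map Fin.valEmbedding).filter fun i => cornerCol n j (inputStore P).path i / k =
      endCol n j (inputStore P).path i / k) (by
      intro q hq
      obtain ⟨hq1, hq2⟩ := Finset.mem_filter.1 hq
      refine ⟨hlt q hq1, hq2, fun e he hne hadj => ?_⟩
      obtain ⟨he1, -⟩ := Finset.mem_filter.1 he
      obtain ⟨i, hi, rfl⟩ := Finset.mem_map.1 hq1
      obtain ⟨i', hi', rfl⟩ := Finset.mem_map.1 he1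
      have hii : i ≠ i' := fun h => hne (by rw [h])
      exact hS.isIndepSet hi hi' hii ((adj_iff_meets P i i').2 ⟨hii, hadj⟩))
  have hsplit := Finset.card_filter_add_card_filter_not (s := S.map Fin.valEmbedding)
    (fun i => cornerCol n j (inputStore P).path i / k = endCol n j (inputStore P).path i / k)
  rw [hcard] at hcut hsplit
  have := Nat.mul_le_mul_left k hle
  rw [show (shiftSystem n k j (inputStore P).path).n = n from rfl] at this
  have hsplit' := congrArg (k * ·) hsplit
  simp only [mul_add] at hsplit'
  simp only [ne_eq] at hcut
  omega

/-- The time bound, as a power of the number of paths. -/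
theorem time_bound {ε : ℝ} {c A : ℕ} (hε : 0 < ε) (hk : k = ⌈(c : ℝ) / ε⌉₊ + 1) (n : ℕ) :
    ((20 + A * ((k + k + 1) ^ 2 * (n + n + 1) ^ 2 * (n + 1) ^ (k + k)) : ℕ) : ℝ) ≤
      ((20 + A * ((k + k + 1) ^ 2 * 3 ^ 2 * 2 ^ (k + k)) : ℕ) : ℝ) * ((max n 1 : ℕ) : ℝ) ^ 6 *
        ((max n 1 : ℕ) : ℝ) ^ (3 * (c : ℝ) / ε) := by
  set m := max n 1 with hm
  have hm1 : 1 ≤ m := le_max_right _ _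
  have hnm : n ≤ m := le_max_left _ _
  have h1 : 20 + A * ((k + k + 1) ^ 2 * (n + n + 1) ^ 2 * (n + 1) ^ (k + k)) ≤
      (20 + A * ((k + k + 1) ^ 2 * 3 ^ 2 * 2 ^ (k + k))) * m ^ (2 + (k + k)) := by
    calc 20 + A * ((k + k + 1) ^ 2 * (n + n + 1) ^ 2 * (n + 1) ^ (k + k))
        ≤ 20 * m ^ (2 + (k + k)) +
            A * ((k + k + 1) ^ 2 * (3 * m) ^ 2 * (2 * m) ^ (k + k)) := by
          gcongr
          · exact Nat.le_mul_of_pos_right _ (Nat.pow_pos hm1)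
          · omega
          · omega
      _ = _ := by rw [mul_pow, mul_pow]; ring
  have hmr : (1 : ℝ) ≤ (m : ℝ) := by exact_mod_cast hm1
  have hk2 : (k : ℝ) ≤ (c : ℝ) / ε + 2 := by
    have := (Nat.ceil_lt_add_one (show 0 ≤ (c : ℝ) / ε by positivity)).le
    rw [hk]; push_cast; linarith
  -- For the exponents, 2 + 2k ≤ 6 + 2c/ε ≤ 6 + 3c/ε.
  have h2 : (m : ℝ) ^ (2 + (k + k)) ≤ (m : ℝ) ^ 6 * (m : ℝ) ^ (3 * (c : ℝ) / ε) := by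
    rw [← Real.rpow_natCast, ← Real.rpow_natCast, ← Real.rpow_add (by linarith)]
    refine Real.rpow_le_rpow_of_exponent_le hmr ?_
    have : 0 ≤ (c : ℝ) / ε := by positivity
    rw [mul_div_assoc]
    push_cast
    linarith
  calc ((20 + A * ((k + k + 1) ^ 2 * (n + n + 1) ^ 2 * (n + 1) ^ (k + k)) : ℕ) : ℝ)
      ≤ (((20 + A * ((k + k + 1) ^ 2 * 3 ^ 2 * 2 ^ (k + k))) * m ^ (2 + (k + k)) : ℕ) : ℝ) := by
        exact_mod_cast h1
    _ = ((20 + A * ((k + k + 1) ^ 2 * 3 ^ 2 * 2 ^ (k + k)) : ℕ) : ℝ) *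
          (m : ℝ) ^ (2 + (k + k)) := by push_cast; ring
    _ ≤ _ := by
        exact (mul_le_mul_of_nonneg_left h2 (Nat.cast_nonneg _)).trans_eq (mul_assoc _ _ _).symm

end

end EPG

/-- There is one exponent `d` such that for all constants `c` and `ε > 0` some program finds, on
every `B₁`-EPG representation with `n` paths whose horizontal parts have length at most `c`, an
independent set of size at least `(1 - ε) OPT` in at most `C n ^ d n ^ (3 c / ε)` steps, `C`
depending on `c` and `ε` only. -/
theorem theorem2 :
    ∃ d : ℕ, ∀ (c : ℕ) (ε : ℝ), 0 < ε →
      ∃ (prog : EPG.Program) (C : ℝ),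
        ∀ (n : ℕ) (P : Fin n → EPG.OneBendPath), (∀ i, (P i).horLength ≤ c) →
          ∃ (t : ℕ) (s : EPG.Store),
            EPG.Run prog (EPG.inputStore P) t s ∧
            (EPG.epgGraph P).IsIndepSet (EPG.outputSet n s : Set (Fin n)) ∧
            (1 - ε) * ((EPG.epgGraph P).indepNum : ℝ) ≤ ((EPG.outputSet n s).card : ℝ) ∧
            (t : ℝ) ≤ C * ((max n 1 : ℕ) : ℝ) ^ d * ((max n 1 : ℕ) : ℝ) ^ (3 * (c : ℝ) / ε) := by
  refine ⟨6, fun c ε hε => ?_⟩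
  -- The summand 1 keeps k positive when c = 0.
  obtain ⟨k, hk⟩ : ∃ k, k = ⌈(c : ℝ) / ε⌉₊ + 1 := ⟨_, rfl⟩
  refine ⟨EPG.slabProgram k, ((20 + (EPG.powerProgram.cost (fun _ => 1) +
    EPG.mainProgram.cost (fun _ => 1)) * ((k + k + 1) ^ 2 * 3 ^ 2 * 2 ^ (k + k)) : ℕ) : ℝ),
    fun n P hc => ?_⟩
  obtain ⟨t, s, hrun, hsol, hval, ht⟩ := EPG.run_slabProgram (k := k) (s := EPG.inputStore P)
    (fun r hr => by simp [EPG.inputStore, hr]) (fun a ha x => by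
      simp only [EPG.inputStore]
      split_ifs <;> omega)
  have h0 : (EPG.inputStore P).reg 0 = n := rfl
  rw [h0] at hsol hval ht
  obtain ⟨hind, hcard⟩ := hsol.outputSet
  refine ⟨t, s, hrun, hind, ?_, le_trans (Nat.cast_le.2 ht) (EPG.time_bound hε hk n)⟩
  obtain ⟨j, hj, hle⟩ := EPG.exists_value_ge (k := k) (by omega) P hc
  have hle' := hle.trans (Nat.add_le_add_right (Nat.mul_le_mul_left k (hval j hj)) _)
  rw [hcard]
  have hck : (c : ℝ) ≤ ε * k := by
    have := Nat.le_ceil ((c : ℝ) / ε)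
    rw [div_le_iff₀ hε] at this
    rw [hk]; push_cast; nlinarith
  have hk0 : (0 : ℝ) < k := by rw [hk]; positivity
  have hreal : (k : ℝ) * (EPG.epgGraph P).indepNum ≤
      k * s.reg 25 + c * (EPG.epgGraph P).indepNum := by exact_mod_cast hle'
  have hmul := mul_le_mul_of_nonneg_right hck (Nat.cast_nonneg (α := ℝ) (EPG.epgGraph P).indepNum)
  -- Multiplied by k, the claim follows from k(1 - ε) OPT ≤ k OPT - c OPT, which is at most k times
  -- the size found.
  refine le_of_mul_le_mul_left ?_ hk0
  linarith
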